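/- Let $\mathbb{K}$ be a field, $m\ge 1$, and $0\le k\le n$ with $k\equiv n \pmod 2$. For crossingless matchings without internal components (closed circles) $a$ from $q$ to $r$ points and $b$ from $p$ to $q$ points, let $ab$ be the matching obtained by stacking $a$ on top of $b$ and deleting the circles that arise, and let $\Phi(a,b)$ be the number of these circles; let $a^*$ be the reflection of $a$ in a horizontal line. The Kauffman monoid $\mathcal{K}_n$ is the set of pairs $(a,i)$ of a crossingless matching $a$ from $n$ to $n$ points without circles and an integer $i\ge 0$, with product $(a,i)(b,j)=(ab,\,i+j+\Phi(a,b))$; the $m$-cyclic Temperley–Lieb monoid $m\mathcal{TL}_n$ is defined in the same way with $i\in\mathbb{Z}/m$. For $\delta\in\mathbb{K}$, the Temperley–Lieb algebra $\mathcal{TL}_n^{lin}(\delta)$ is the quotient of $\mathbb{K}\mathcal{K}_n$ by the relation $(\mathrm{Id}_n,1)=\delta\cdot 1$. Let $B_k^n$ be the set of crossingless matchings without circles from $k$ points (bottom) to $n$ points (top) in which no strand has both ends at the bottom, and let $\mathcal{J}_k\subseteq m\mathcal{TL}_n$ be the set of diagrams with exactly $k$ through strands. Let $W(k)$ be the $\mathcal{TL}_n^{lin}(\delta)$-representation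 with basis $B_k^n$ on which diagrams act by concatenation, where each circle is replaced by $\delta$ and a result not in $B_k^n$ is replaced by $0$. Its bilinear form is $\langle x,y\rangle_k=\delta^{\Phi(x^*,y)}$ if $x^*y=\mathrm{Id}_k$ and $0$ otherwise; let $R(k)$ be the radical of this form and $L(k)=W(k)/R(k)$. Let $\mathcal{C}_m=\mathbb{Z}/m$, and let $\Delta(k)$ be the span of $B_k^n\times\mathcal{C}_m$, on which $m\mathcal{TL}_n$ acts by concatenation (circles are counted modulo $m$ in the second entry, and a result whose first entry is not in $B_k^n$ is replaced by $0$) and the group algebra $\mathbb{K}\mathcal{C}_m$ acts on the second entry by translation. Let $\nabla(k)$ be the same space with $m\mathcal{TL}_n$ acting from the right through $*$. Let $\phi^k:\nabla(k)\times\Delta(k)\to\mathbb{K}\mathcal{C}_m$ be the bilinear map with $\phi^k((x,i),(y,j))=i+j+\Phi(x^*,y)\in\mathcal{C}_m$ if $x^*y=\mathrm{Id}_k$ and $0$ otherwise. For a $\mathbb{K}\mathcal{C}_m$-module $K$, put $\Delta(k,K)=\Delta(k)\otimes_{\mathbb{K}\mathcal{C}_m}K$, let $R(k,K)$ be the kernel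 of the map $\Delta(k,K)\to\mathrm{Hom}_{\mathbb{K}}(\nabla(k),\mathbb{K}\mathcal{C}_m)\otimes_{\mathbb{K}\mathcal{C}_m}K$ induced by $\phi^k$, and put $L(k,K)=\Delta(k,K)/R(k,K)$. Theorem. Suppose $\mathbb{K}$ contains a primitive $m$-th root of unity. Let $\zeta_m\in\mathbb{K}$ be an $m$-th root of unity (not necessarily primitive), and let $K$ be the corresponding simple $\mathcal{C}_m$-representation, on which the generator $1\in\mathbb{Z}/m$ acts as multiplication by $\zeta_m$. Then $R(k,K)$ is the radical of $\Delta(k,K)$, so that $L(k,K)$ is the head of $\Delta(k,K)$; $L(k,K)$ is a simple $m\mathcal{TL}_n$-representation with apex $\mathcal{J}_k$ (that is, $\mathcal{J}_k$ is a two-sided cell that contains an idempotent and does not act by zero on $L(k,K)$, and it is maximal with these properties in the order on two-sided cells in which $a\le b$ if and only if $b=cad$ for some $c,d$); and, for $\delta=\zeta_m$, $L(k)$ is a simple $\mathcal{TL}_n^{lin}(\zeta_m)$-representation. Both are finite-dimensional, and \[\dim_{\mathbb{K}}L(k,K)=\dim_{\mathbb{K}}L(k).\] -/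

import Mathlib

/-- Position of a boundary point on the boundary of the strip, read along the bottom line from left
to right (`Sum.inl`) and then along the top line from right to left (`Sum.inr`). -/
def boundaryPos {l n : ℕ} : Fin l ⊕ Fin n → ℕ :=
  Sum.elim (fun i => (i : ℕ)) (fun j => l + (j.rev : ℕ))

/-- Crossingless matchings without internal components, from `l` bottom points (`Sum.inl`) to `n` top
points (`Sum.inr`), up to equivalence: each boundary point has a partner, the other end of its strand,
and no two strands interleave along the boundary of the strip. -/
@[ext]
structure TLDiagram (l n : ℕ) where
  partner : Fin l ⊕ Fin n → Fin l ⊕ Fin n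
  partner_partner : ∀ p, partner (partner p) = p
  partner_ne : ∀ p, partner p ≠ p
  noncrossing : ∀ p q, ¬ (boundaryPos p < boundaryPos q ∧
    boundaryPos q < boundaryPos (partner p) ∧
    boundaryPos (partner p) < boundaryPos (partner q))

namespace TLDiagram

theorem boundaryPos_injective {l n : ℕ} :
    Function.Injective (boundaryPos : Fin l ⊕ Fin n → ℕ) := by
  rintro (i | i) (j | j) h
  all_goals simp only [boundaryPos, Sum.elim_inl, Sum.elim_inr, Fin.val_rev] at h
  · congr 1; ext; omega
  · omega
  · omega
  · congr 1; ext; omega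

/-- The identity diagram: `n` vertical strands. -/
def idDiag (n : ℕ) : TLDiagram n n where
  partner := Sum.swap
  partner_partner := Sum.swap_swap
  partner_ne := by rintro (i | i) <;> simp
  noncrossing := by
    rintro (i | i) (j | j)
    all_goals simp only [boundaryPos, Sum.elim_inl, Sum.elim_inr, Fin.val_rev, Sum.swap_inl,
      Sum.swap_inr]
    all_goals omega

/-- Reflection of a diagram across the horizontal middle line. -/
def reflect {l n : ℕ} (a : TLDiagram l n) : TLDiagram n l where
  partner p := (a.partner p.swap).swap
  partner_partner p := by simp [a.partner_partner]
  partner_ne p h := a.partner_ne p.swap (by rw [← Sum.swap_swap (a.partner p.swap), h])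
  noncrossing := by
    have key : ∀ p : Fin n ⊕ Fin l,
        boundaryPos p + boundaryPos p.swap + 1 = l + n := by
      rintro (i | i)
      all_goals simp only [boundaryPos, Sum.elim_inl, Sum.elim_inr, Fin.val_rev, Sum.swap_inl,
        Sum.swap_inr]
      all_goals omega
    intro p q
    have h1 := key p
    have h2 := key q
    have h3 := key (a.partner p.swap).swap
    have h4 := key (a.partner q.swap).swap
    have h5 := a.noncrossing (a.partner q.swap) (a.partner p.swap)
    rw [a.partner_partner, a.partner_partner] at h5
    rw [Sum.swap_swap] at h3 h4
    omega

section Gluing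

variable {l m n : ℕ}

/-- In the picture obtained by gluing a diagram from `l` to `m` points below another one, a point is
a bottom, middle or top point. This is the partner along the lower diagram; top points stay put. -/
def lowerStep (b : TLDiagram l m) : Fin l ⊕ Fin m ⊕ Fin n → Fin l ⊕ Fin m ⊕ Fin n
  | .inl i => Sum.map id Sum.inl (b.partner (.inl i))
  | .inr (.inl j) => Sum.map id Sum.inl (b.partner (.inr j))
  | .inr (.inr k) => .inr (.inr k)

/-- The partner along the upper diagram; bottom points stay put. -/
def upperStep (a : TLDiagram m n) : Fin l ⊕ Fin m ⊕ Fin n → Fin l ⊕ Fin m ⊕ Fin n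
  | .inl i => .inl i
  | .inr p => .inr (a.partner p)

/-- Two points of the glued picture are connected if they lie on the same component. -/
def Connected (a : TLDiagram m n) (b : TLDiagram l m) : Setoid (Fin l ⊕ Fin m ⊕ Fin n) :=
  Relation.EqvGen.setoid fun u v => v = lowerStep b u ∨ v = upperStep a u

/-- Inclusion of the boundary points into the glued picture. -/
def outer : Fin l ⊕ Fin n → Fin l ⊕ Fin m ⊕ Fin n :=
  Sum.map id Sum.inr

/-- The number of internal components created by stacking `a` on top of `b`: the components of the
glued picture that do not meet the boundary. -/
noncomputable def loops (a : TLDiagram m n) (b : TLDiagram l m) : ℕ :=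
  Nat.card {c : Quotient (Connected a b) //
    ∀ p : Fin l ⊕ Fin n, (Quotient.mk (Connected a b) (outer p)) ≠ c}

theorem lowerStep_invol (b : TLDiagram l m) (u : Fin l ⊕ Fin m ⊕ Fin n) :
    lowerStep b (lowerStep b u) = u := by
  have key : ∀ p : Fin l ⊕ Fin m,
      lowerStep b (Sum.map id Sum.inl p : Fin l ⊕ Fin m ⊕ Fin n) =
        Sum.map id Sum.inl (b.partner p) := by
    rintro (i | i) <;> rfl
  rcases u with i | j | k
  · change lowerStep b (Sum.map id Sum.inl (b.partner (.inl i))) = _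
    rw [key, b.partner_partner]; rfl
  · change lowerStep b (Sum.map id Sum.inl (b.partner (.inr j))) = _
    rw [key, b.partner_partner]; rfl
  · rfl

theorem upperStep_invol (a : TLDiagram m n) (u : Fin l ⊕ Fin m ⊕ Fin n) :
    upperStep a (upperStep a u) = u := by
  rcases u with i | p
  · rfl
  · simp [upperStep, a.partner_partner]

theorem lowerStep_fixed (b : TLDiagram l m) (u : Fin l ⊕ Fin m ⊕ Fin n) :
    lowerStep b u = u ↔ ∃ k, u = .inr (.inr k) := by
  have inj : Function.Injective
      (Sum.map id Sum.inl : Fin l ⊕ Fin m → Fin l ⊕ Fin m ⊕ Fin n) :=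
    Function.injective_id.sumMap Sum.inl_injective
  rcases u with i | j | k
  · refine iff_of_false (fun h => b.partner_ne (.inl i) (inj h)) (by simp)
  · refine iff_of_false (fun h => b.partner_ne (.inr j) (inj h)) (by simp)
  · simp [lowerStep]

theorem upperStep_fixed (a : TLDiagram m n) (u : Fin l ⊕ Fin m ⊕ Fin n) :
    upperStep a u = u ↔ ∃ i, u = .inl i := by
  rcases u with i | p
  · simp [upperStep]
  · simp [upperStep, a.partner_ne]

/-- A point fixed by one of two involutions without common fixed points on a finite set is connected
to exactly one other point fixed by one of them. -/
theorem existsUnique_other_end {X : Type*} [Finite X] (f g : X → X) (hf : ∀ u, f (f u) = u)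
    (hg : ∀ u, g (g u) = u) (hfg : ∀ u, ¬ (f u = u ∧ g u = u)) (x : X) (hx : g x = x) :
    ∃! y, y ≠ x ∧ Relation.EqvGen (fun u v => v = f u ∨ v = g u) x y ∧ (f y = y ∨ g y = y) := by
  classical
  set s : X → X := fun u => g (f u) with hs
  have sinj : Function.Injective s := fun u v h => by
    have h1 : f u = f v := by rw [← hg (f u), ← hg (f v)]; exact congrArg g h
    rw [← hf u, ← hf v, h1]
  have hper : x ∈ Function.periodicPts s := sinj.mem_periodicPts x
  set t := Function.minimalPeriod s x with ht
  have htpos : 0 < t := Function.minimalPeriod_pos_of_mem_periodicPts hper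
  have hst : s^[t] x = x := Function.iterate_minimalPeriod
  -- reflections of the orbit
  have hgs : ∀ i j, s^[i + j] x = x → g (s^[i] x) = s^[j] x := by
    intro i
    induction i with
    | zero =>
      intro j h
      rw [Nat.zero_add] at h
      rw [h]; exact hx
    | succ i ih =>
      intro j h
      have h1 := ih (j + 1) (by rw [← h]; congr 1; omega)
      rw [Function.iterate_succ_apply'] at h1 ⊢
      simp only [hs] at h1 ⊢
      rw [hg]
      have h2 : s^[i] x = f (s^[j] x) := by
        have h3 := congrArg g h1
        rw [hg, hg] at h3
        exact h3
      have h4 := congrArg f h2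
      rw [hf] at h4
      exact h4
  have hmod : ∀ i, s^[i + (t - i % t)] x = x := by
    intro i
    have : i + (t - i % t) = t * (i / t + 1) := by
      have h1 := Nat.div_add_mod i t
      have h2 := Nat.mod_lt i htpos
      rw [Nat.mul_add]; omega
    rw [this]
    exact (Function.isPeriodicPt_minimalPeriod s x).mul_const _
  have hfs : ∀ i, f (s^[i] x) = g (s^[i + 1] x) := by
    intro i
    rw [Function.iterate_succ_apply']
    simp only [hs]
    rw [hg]
  have orbit : ∀ y, Relation.EqvGen (fun u v => v = f u ∨ v = g u) x y → ∃ i, y = s^[i] x := by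
    have closed : ∀ u v, (v = f u ∨ v = g u) → ((∃ i, u = s^[i] x) ↔ ∃ i, v = s^[i] x) := by
      have hf' : ∀ u, (∃ i, u = s^[i] x) → ∃ i, f u = s^[i] x := by
        rintro u ⟨i, rfl⟩
        exact ⟨_, by rw [hfs]; exact hgs _ _ (hmod (i + 1))⟩
      have hg' : ∀ u, (∃ i, u = s^[i] x) → ∃ i, g u = s^[i] x := by
        rintro u ⟨i, rfl⟩
        exact ⟨_, hgs _ _ (hmod i)⟩
      rintro u v (rfl | rfl)
      · exact ⟨hf' u, fun h => by simpa [hf] using hf' _ h⟩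
      · exact ⟨hg' u, fun h => by simpa [hg] using hg' _ h⟩
    intro y h
    have key : ∀ u v, Relation.EqvGen (fun u v => v = f u ∨ v = g u) u v →
        ((∃ i, u = s^[i] x) ↔ ∃ i, v = s^[i] x) := by
      intro u v h
      induction h with
      | rel u v h => exact closed u v h
      | refl => exact Iff.rfl
      | symm u v _ ih => exact ih.symm
      | trans u v w _ _ ih1 ih2 => exact ih1.trans ih2
    exact (key x y h).1 ⟨0, rfl⟩
  have conn : ∀ i, Relation.EqvGen (fun u v => v = f u ∨ v = g u) x (s^[i] x) := by
    intro i
    induction i with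
    | zero => exact Relation.EqvGen.refl _
    | succ i ih =>
      rw [Function.iterate_succ_apply']
      exact (ih.trans _ _ _ (Relation.EqvGen.rel _ _ (Or.inl rfl))).trans _ _ _
        (Relation.EqvGen.rel _ _ (Or.inr rfl))
  have hinj : ∀ i j, i < t → j < t → s^[i] x = s^[j] x → i = j := by
    intro i j hi hj h
    exact (Function.iterate_injOn_Iio_minimalPeriod (f := s) (x := x)) hi hj h
  have hzero : ∀ i, s^[i] x = x ↔ t ∣ i := fun i =>
    Function.isPeriodicPt_iff_minimalPeriod_dvd
  have hred : ∀ i, ∃ j, j < t ∧ s^[i] x = s^[j] x := fun i =>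
    ⟨i % t, Nat.mod_lt _ htpos, (Function.iterate_mod_minimalPeriod_eq).symm⟩
  -- fixed points along the orbit
  have gfix : ∀ i, i < t → (g (s^[i] x) = s^[i] x ↔ t ∣ 2 * i) := by
    intro i hi
    rw [← hzero, two_mul]
    constructor
    · intro h
      have h1 := hgs i (t - i) (by rw [Nat.add_sub_cancel' hi.le]; exact hst)
      rw [h] at h1
      rw [Function.iterate_add_apply, h1, ← Function.iterate_add_apply, Nat.add_sub_cancel' hi.le,
        hst]
    · exact hgs i i
  have ffix : ∀ i, i < t → (f (s^[i] x) = s^[i] x ↔ t ∣ 2 * i + 1) := by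
    intro i hi
    rw [← hzero, hfs]
    constructor
    · intro h
      have h1 := hgs (i + 1) (t - (i + 1)) (by rw [Nat.add_sub_cancel' hi]; exact hst)
      rw [h] at h1
      rw [show 2 * i + 1 = i + 1 + i by ring, Function.iterate_add_apply, h1,
        ← Function.iterate_add_apply, Nat.add_sub_cancel' hi, hst]
    · intro h
      exact hgs (i + 1) i (by rw [← h]; congr 1; omega)
  have only : ∀ i, i < t → i ≠ 0 → (t ∣ 2 * i + 1 ∨ t ∣ 2 * i) → i = t / 2 := by
    rintro i hi h0 (⟨c, hc⟩ | ⟨c, hc⟩)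
    · have : c = 1 := by
        rcases c with _ | _ | c
        · omega
        · rfl
        · nlinarith
      subst this; omega
    · have : c = 1 := by
        rcases c with _ | _ | c
        · omega
        · rfl
        · nlinarith
      subst this; omega
  have ht1 : t ≠ 1 := by
    intro h
    have h1 : s x = x := by simpa [h] using hst
    refine hfg x ⟨?_, hx⟩
    have h2 := congrArg g h1
    simp only [hs] at h2
    rw [hg, hx] at h2
    exact h2
  refine ⟨s^[t / 2] x, ⟨?_, conn _, ?_⟩, ?_⟩
  · intro h
    have := hinj (t / 2) 0 (by omega) htpos h
    omega
  · rcases Nat.even_or_odd' t with ⟨c, hc | hc⟩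
    · right
      rw [gfix _ (by omega)]
      exact ⟨1, by omega⟩
    · left
      rw [ffix _ (by omega)]
      exact ⟨1, by omega⟩
  · rintro y ⟨hne, hc, hfix⟩
    obtain ⟨i, rfl⟩ := orbit y hc
    obtain ⟨j, hj, hij⟩ := hred i
    rw [hij] at hne hfix ⊢
    rw [ffix j hj, gfix j hj] at hfix
    rw [only j hj (by rintro rfl; exact hne rfl) hfix]

theorem outer_injective : Function.Injective (outer : Fin l ⊕ Fin n → Fin l ⊕ Fin m ⊕ Fin n) :=
  Function.injective_id.sumMap Sum.inr_injective

theorem existsUnique_outer (a : TLDiagram m n) (b : TLDiagram l m) (p : Fin l ⊕ Fin n) :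
    ∃! q : Fin l ⊕ Fin n, q ≠ p ∧ Connected a b (outer p) (outer q) := by
  have hno : ∀ u : Fin l ⊕ Fin m ⊕ Fin n, ¬ (lowerStep b u = u ∧ upperStep a u = u) := by
    intro u
    rw [lowerStep_fixed, upperStep_fixed]
    rintro ⟨⟨i, rfl⟩, ⟨j, h⟩⟩
    simp at h
  have hout : ∀ u : Fin l ⊕ Fin m ⊕ Fin n, (lowerStep b u = u ∨ upperStep a u = u) ↔
      ∃ q : Fin l ⊕ Fin n, u = outer q := by
    intro u
    rw [lowerStep_fixed, upperStep_fixed]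
    constructor
    · rintro (⟨k, rfl⟩ | ⟨i, rfl⟩)
      · exact ⟨.inr k, rfl⟩
      · exact ⟨.inl i, rfl⟩
    · rintro ⟨i | k, rfl⟩
      · exact Or.inr ⟨i, rfl⟩
      · exact Or.inl ⟨k, rfl⟩
  have main : ∃! y : Fin l ⊕ Fin m ⊕ Fin n, y ≠ outer p ∧ Connected a b (outer p) y ∧
      (lowerStep b y = y ∨ upperStep a y = y) := by
    rcases p with i | k
    · exact existsUnique_other_end _ _ (lowerStep_invol b) (upperStep_invol a) hno _ rfl
    · have := existsUnique_other_end (upperStep a) (lowerStep b) (upperStep_invol a)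
        (lowerStep_invol b) (fun u h => hno u h.symm) (outer (.inr k)) rfl
      have e : (fun u v : Fin l ⊕ Fin m ⊕ Fin n => v = upperStep a u ∨ v = lowerStep b u) =
          fun u v => v = lowerStep b u ∨ v = upperStep a u := by
        funext u v; exact propext or_comm
      rw [e] at this
      have e' : ∀ y : Fin l ⊕ Fin m ⊕ Fin n, (upperStep a y = y ∨ lowerStep b y = y) ↔
          (lowerStep b y = y ∨ upperStep a y = y) := fun y => or_comm
      simp only [e'] at this
      exact this
  obtain ⟨y, ⟨h1, h2, h3⟩, h4⟩ := main
  obtain ⟨q, rfl⟩ := (hout y).1 h3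
  refine ⟨q, ⟨fun h => h1 (by rw [h]), h2⟩, ?_⟩
  rintro q' ⟨h5, h6⟩
  exact outer_injective (h4 (outer q') ⟨fun h => h5 (outer_injective h), h6, (hout _).2 ⟨q', rfl⟩⟩)

/-- The indicator of `i < j`, modulo 2. -/
def ltInd (i j : ℕ) : ZMod 2 := if i < j then 1 else 0

/-- Two disjoint unions of strands interleave an even number of times. -/
theorem interleave_even (d : TLDiagram l n) (P Q : Fin l ⊕ Fin n → ZMod 2)
    (hP : ∀ x, P (d.partner x) = P x) (hQ : ∀ x, Q (d.partner x) = Q x)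
    (hPQ : ∀ x, P x = 0 ∨ Q x = 0) :
    ∑ y, Q y * ∑ x, P x * ltInd (boundaryPos x) (boundaryPos y) = 0 := by
  simp only [ltInd]
  refine Finset.sum_involution (fun y _ => d.partner y) ?_ (fun y _ _ => d.partner_ne y)
    (fun y _ => Finset.mem_univ _) (fun y _ => d.partner_partner y)
  intro y _
  rw [hQ, ← mul_add, ← Finset.sum_add_distrib]
  rcases hPQ y with hy | hy
  · have : ∑ x, (P x * (if boundaryPos x < boundaryPos y then 1 else 0) +
        P x * (if boundaryPos x < boundaryPos (d.partner y) then 1 else 0)) = 0 := by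
      refine Finset.sum_involution (fun x _ => d.partner x) ?_ (fun x _ _ => d.partner_ne x)
        (fun x _ => Finset.mem_univ _) (fun x _ => d.partner_partner x)
      intro x _
      rw [hP, ← mul_add, ← mul_add, ← mul_add]
      by_cases hx : P x = 0
      · simp [hx]
      have n1 : boundaryPos x ≠ boundaryPos y := fun h => hx (by
        rw [boundaryPos_injective h]; exact hy)
      have n2 : boundaryPos x ≠ boundaryPos (d.partner y) := fun h => hx (by
        rw [boundaryPos_injective h, hP]; exact hy)
      have n3 : boundaryPos (d.partner x) ≠ boundaryPos y := fun h => hx (by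
        rw [← hP, boundaryPos_injective h]; exact hy)
      have n4 : boundaryPos (d.partner x) ≠ boundaryPos (d.partner y) := fun h => hx (by
        rw [← hP, boundaryPos_injective h, hP]; exact hy)
      have e1 := d.noncrossing x y
      have e2 := d.noncrossing x (d.partner y)
      have e3 := d.noncrossing (d.partner x) y
      have e4 := d.noncrossing (d.partner x) (d.partner y)
      have e5 := d.noncrossing y x
      have e6 := d.noncrossing y (d.partner x)
      have e7 := d.noncrossing (d.partner y) x
      have e8 := d.noncrossing (d.partner y) (d.partner x)
      simp only [d.partner_partner] at e1 e2 e3 e4 e5 e6 e7 e8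
      have : ((if boundaryPos x < boundaryPos y then 1 else 0) +
          (if boundaryPos x < boundaryPos (d.partner y) then 1 else 0) +
          ((if boundaryPos (d.partner x) < boundaryPos y then 1 else 0) +
          (if boundaryPos (d.partner x) < boundaryPos (d.partner y) then 1 else 0)) : ZMod 2)
          = 0 := by
        split_ifs <;> first | decide | (exfalso; omega)
      rw [this, mul_zero]
    rw [this, mul_zero]
  · rw [hy, zero_mul]

theorem sum_even (d : TLDiagram l n) (P : Fin l ⊕ Fin n → ZMod 2)
    (hP : ∀ x, P (d.partner x) = P x) : ∑ x, P x = 0 := by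
  have two : ∀ z : ZMod 2, z + z = 0 := by decide
  refine Finset.sum_involution (fun y _ => d.partner y) ?_ (fun y _ _ => d.partner_ne y)
    (fun y _ => Finset.mem_univ _) (fun y _ => d.partner_partner y)
  intro y _
  rw [hP, two]

theorem connected_lower (a : TLDiagram m n) (b : TLDiagram l m) (p : Fin l ⊕ Fin m) :
    Connected a b (Sum.map id Sum.inl p) (Sum.map id Sum.inl (b.partner p)) := by
  refine Relation.EqvGen.rel _ _ (Or.inl ?_)
  rcases p with i | j <;> rfl

theorem connected_upper (a : TLDiagram m n) (b : TLDiagram l m) (p : Fin m ⊕ Fin n) :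
    Connected a b (Sum.inr p) (Sum.inr (a.partner p)) :=
  Relation.EqvGen.rel _ _ (Or.inr rfl)

/-- The composite `a ∘ b`, obtained by stacking `a` on top of `b` and forgetting the internal
components: the partner of a boundary point is the other boundary point of its component. -/
noncomputable def comp (a : TLDiagram m n) (b : TLDiagram l m) : TLDiagram l n where
  partner p := (existsUnique_outer a b p).choose
  partner_partner p := by
    have h1 := (existsUnique_outer a b p).choose_spec.1
    have h2 := (existsUnique_outer a b (existsUnique_outer a b p).choose).choose_spec.2 p
      ⟨h1.1.symm, (Connected a b).symm h1.2⟩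
    exact h2.symm
  partner_ne p := (existsUnique_outer a b p).choose_spec.1.1
  noncrossing := by
    classical
    intro p q
    have hp := (existsUnique_outer a b p).choose_spec
    have hq := (existsUnique_outer a b q).choose_spec
    generalize (existsUnique_outer a b p).choose = p' at hp ⊢
    generalize (existsUnique_outer a b q).choose = q' at hq ⊢
    obtain ⟨⟨hp1, hp2⟩, hp3⟩ := hp
    obtain ⟨⟨hq1, hq2⟩, hq3⟩ := hq
    simp only at hp3 hq3
    rintro ⟨c1, c2, c3⟩
    have npq : ¬ Connected a b (outer p) (outer q) := by
      intro h
      have hne : q ≠ p := by rintro rfl; omega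
      have := hp3 q ⟨hne, h⟩
      subst this; omega
    -- indicator functions of the two components
    set P : Fin l ⊕ Fin m ⊕ Fin n → ZMod 2 :=
      fun u => if Connected a b (outer p) u then 1 else 0 with hPdef
    set Q : Fin l ⊕ Fin m ⊕ Fin n → ZMod 2 :=
      fun u => if Connected a b (outer q) u then 1 else 0 with hQdef
    have inv : ∀ r u v : Fin l ⊕ Fin m ⊕ Fin n, Connected a b u v →
        ((if Connected a b r v then 1 else 0 : ZMod 2) = if Connected a b r u then 1 else 0) := by
      intro r u v h
      have : Connected a b r v ↔ Connected a b r u :=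
        ⟨fun h1 => (Connected a b).trans h1 ((Connected a b).symm h),
          fun h1 => (Connected a b).trans h1 h⟩
      simp only [this]
    have hPQ : ∀ u, P u = 0 ∨ Q u = 0 := by
      intro u
      by_cases h1 : Connected a b (outer p) u
      · right
        have : ¬ Connected a b (outer q) u := fun h2 =>
          npq ((Connected a b).trans h1 ((Connected a b).symm h2))
        simp [hQdef, this]
      · left; simp [hPdef, h1]
    have lowP := fun x => inv (outer p) _ _ (connected_lower a b x)
    have lowQ := fun x => inv (outer q) _ _ (connected_lower a b x)
    have upP := fun x => inv (outer p) _ _ (connected_upper a b x)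
    have upQ := fun x => inv (outer q) _ _ (connected_upper a b x)
    have L0 := interleave_even b (fun x => P (Sum.map id Sum.inl x))
      (fun x => Q (Sum.map id Sum.inl x)) lowP lowQ (fun x => hPQ _)
    have U0 := interleave_even a (fun x => P (Sum.inr x)) (fun x => Q (Sum.inr x)) upP upQ
      (fun x => hPQ _)
    have LP := sum_even b (fun x => P (Sum.map id Sum.inl x)) lowP
    have LQ := sum_even b (fun x => Q (Sum.map id Sum.inl x)) lowQ
    have UP := sum_even a (fun x => P (Sum.inr x)) upP
    have UQ := sum_even a (fun x => Q (Sum.inr x)) upQ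
    -- on the boundary the two components are `{p, p'}` and `{q, q'}`
    have bP : ∀ x : Fin l ⊕ Fin n, P (outer x) =
        (if p = x then 1 else 0) + (if p' = x then 1 else 0) := by
      intro x
      by_cases h1 : p = x
      · subst h1
        simp [hPdef, hp1]
      · by_cases h2 : p' = x
        · subst h2
          simp [hPdef, hp1.symm, hp2]
        · have : ¬ Connected a b (outer p) (outer x) := fun h =>
            h2 (hp3 x ⟨fun h => h1 h.symm, h⟩).symm
          simp [hPdef, h1, h2, this]
    have bQ : ∀ x : Fin l ⊕ Fin n, Q (outer x) =
        (if q = x then 1 else 0) + (if q' = x then 1 else 0) := by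
      intro x
      by_cases h1 : q = x
      · subst h1
        simp [hQdef, hq1]
      · by_cases h2 : q' = x
        · subst h2
          simp [hQdef, hq1.symm, hq2]
        · have : ¬ Connected a b (outer q) (outer x) := fun h =>
            h2 (hq3 x ⟨fun h => h1 h.symm, h⟩).symm
          simp [hQdef, h1, h2, this]
    have T1 : ∑ y : Fin l ⊕ Fin n, Q (outer y) * ∑ x : Fin l ⊕ Fin n, P (outer x) *
        ltInd (boundaryPos x) (boundaryPos y) = 1 := by
      simp only [bP, bQ, add_mul, Finset.sum_add_distrib, ite_mul, one_mul, zero_mul,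
        Finset.sum_ite_eq, Finset.mem_univ, if_true, ltInd]
      rw [if_pos c1, if_neg (by omega : ¬ boundaryPos p' < boundaryPos q), if_pos (by omega),
        if_pos c3]
      decide
    have T0 : ∑ y : Fin l ⊕ Fin n, Q (outer y) * ∑ x : Fin l ⊕ Fin n, P (outer x) *
        ltInd (boundaryPos x) (boundaryPos y) = 0 := by
      clear_value P Q
      have MM : (∑ y : Fin m, Q (.inr (.inl y)) * ∑ x : Fin m, P (.inr (.inl x)) *
            ltInd x.rev y.rev) +
          (∑ y : Fin m, Q (.inr (.inl y)) * ∑ x : Fin m, P (.inr (.inl x)) *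
            ltInd x y) =
          (∑ y : Fin m, Q (.inr (.inl y))) * ∑ x : Fin m, P (.inr (.inl x)) := by
        rw [← Finset.sum_add_distrib, Finset.sum_mul]
        refine Finset.sum_congr rfl fun y _ => ?_
        rw [← mul_add, ← Finset.sum_add_distrib]
        rcases hPQ (.inr (.inl y)) with h | h
        · congr 1
          refine Finset.sum_congr rfl fun x _ => ?_
          rcases lt_trichotomy (x : ℕ) (y : ℕ) with h1 | h1 | h1
          · rw [ltInd, ltInd, if_neg (by simp only [Fin.val_rev]; omega), if_pos h1]; ring
          · rw [Fin.ext h1, h]; ring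
          · rw [ltInd, ltInd, if_pos (by simp only [Fin.val_rev]; omega), if_neg (by omega)]; ring
        · rw [h]; ring
      have lm1 : ∀ (i : Fin l) (j : ℕ), ltInd i (l + j) = 1 := fun i j => if_pos (by omega)
      have lm2 : ∀ (i : Fin l) (j : ℕ), ltInd (l + j) i = 0 := fun i j => if_neg (by omega)
      have mn1 : ∀ (i : Fin m) (j : ℕ), ltInd i (m + j) = 1 := fun i j => if_pos (by omega)
      have mn2 : ∀ (i : Fin m) (j : ℕ), ltInd (m + j) i = 0 := fun i j => if_neg (by omega)
      have sh : ∀ c i j : ℕ, ltInd (c + i) (c + j) = ltInd i j := fun c i j => by simp [ltInd]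
      simp only [Fintype.sum_sum_type, boundaryPos, Sum.elim_inl, Sum.elim_inr, Sum.map_inl,
        Sum.map_inr, outer, id, lm1, lm2, mn1, mn2, sh, mul_one, mul_zero,
        Finset.sum_const_zero, add_zero] at L0 U0 LP LQ UP UQ MM ⊢
      simp only [mul_add, Finset.sum_add_distrib, ← Finset.sum_mul] at L0 U0 ⊢
      have h2 : (2 : ZMod 2) = 0 := by decide
      linear_combination L0 + U0 - MM +
        ((∑ y : Fin l, P (.inl y)) - ∑ y : Fin m, P (.inr (.inl y))) * UQ -
        (∑ y : Fin m, Q (.inr (.inl y))) * (∑ y : Fin l, P (.inl y)) * h2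
    rw [T1] at T0
    exact one_ne_zero T0

theorem connected_outer_iff (a : TLDiagram m n) (b : TLDiagram l m) (p q : Fin l ⊕ Fin n) :
    Connected a b (outer p) (outer q) ↔ q = p ∨ q = (comp a b).partner p := by
  have h := (existsUnique_outer a b p).choose_spec
  constructor
  · intro h1
    by_cases h2 : q = p
    · exact Or.inl h2
    · exact Or.inr (h.2 q ⟨h2, h1⟩)
  · rintro (rfl | rfl)
    · exact (Connected a b).refl _
    · exact h.1.2

end Gluing

/-- A two-colouring of the boundary points is compatible with a diagram if it is constant along
strands. -/
def Compatible {l n : ℕ} (a : TLDiagram l n) (s : Fin l → Bool) (t : Fin n → Bool) : Prop :=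
  ∀ p, Sum.elim s t (a.partner p) = Sum.elim s t p

open Classical in
/-- The incidence matrix of compatible colourings. It serves to prove associativity. -/
noncomputable def mat {l n : ℕ} (a : TLDiagram l n) : Matrix (Fin l → Bool) (Fin n → Bool) ℕ :=
  fun s t => if Compatible a s t then 1 else 0

theorem eq_of_compatible {l n : ℕ} (a b : TLDiagram l n)
    (h : ∀ s t, Compatible a s t → Compatible b s t) : a = b := by
  classical
  ext p
  set f : Fin l ⊕ Fin n → Bool := fun x => decide (x = p ∨ x = a.partner p) with hf
  have hs : Sum.elim (f ∘ Sum.inl) (f ∘ Sum.inr) = f := Sum.elim_comp_inl_inr f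
  have h1 := h (f ∘ Sum.inl) (f ∘ Sum.inr)
  simp only [Compatible, hs] at h1
  have h2 := h1 (by
    intro x
    simp only [hf, decide_eq_decide]
    constructor
    · rintro (h | h)
      · right; rw [← h, a.partner_partner]
      · left; rw [← a.partner_partner x, h, a.partner_partner]
    · rintro (rfl | rfl)
      · exact Or.inr rfl
      · exact Or.inl (a.partner_partner p)) p
  have h3 : b.partner p = p ∨ b.partner p = a.partner p := by
    simpa [hf] using h2
  rcases h3 with h3 | h3
  · exact absurd h3 (b.partner_ne p)
  · exact h3.symm

theorem card_middle {l m n : ℕ} (a : TLDiagram m n) (b : TLDiagram l m) (s : Fin l → Bool)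
    (u : Fin n → Bool) (h : Compatible (comp a b) s u) :
    Nat.card {t : Fin m → Bool // Compatible b s t ∧ Compatible a t u} = 2 ^ loops a b := by
  classical
  set col : (Fin m → Bool) → Fin l ⊕ Fin m ⊕ Fin n → Bool := fun t => Sum.elim s (Sum.elim t u)
    with hcol
  have colL : ∀ t p, col t (Sum.map id Sum.inl p) = Sum.elim s t p := by
    rintro t (i | i) <;> rfl
  have colU : ∀ t p, col t (Sum.inr p) = Sum.elim t u p := fun t p => rfl
  have colO : ∀ t (p : Fin l ⊕ Fin n), col t (outer p) = Sum.elim s u p := by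
    rintro t (i | i) <;> rfl
  have compat : ∀ t, (Compatible b s t ∧ Compatible a t u) ↔
      ∀ x y, Connected a b x y → col t x = col t y := by
    intro t
    constructor
    · rintro ⟨hb, ha⟩ x y hxy
      induction hxy with
      | rel x y hxy =>
        rcases hxy with rfl | rfl
        · rcases x with i | j | k
          · exact ((colL t _).trans (hb (.inl i))).symm
          · exact ((colL t _).trans (hb (.inr j))).symm
          · rfl
        · rcases x with i | p
          · rfl
          · exact (ha p).symm
      | refl => rfl
      | symm _ _ _ ih => exact ih.symm
      | trans _ _ _ _ _ ih1 ih2 => exact ih1.trans ih2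
    · intro hc
      refine ⟨fun p => ?_, fun p => ?_⟩
      · rw [← colL, ← colL]
        exact (hc _ _ (connected_lower a b p)).symm
      · exact (hc _ _ (connected_upper a b p)).symm
  have hcomp : ∀ p q : Fin l ⊕ Fin n, Connected a b (outer p) (outer q) →
      (Sum.elim s u p : Bool) = Sum.elim s u q := by
    intro p q hpq
    rcases (connected_outer_iff a b p q).1 hpq with rfl | rfl
    · rfl
    · exact (h p).symm
  let C := {c : Quotient (Connected a b) //
    ∀ p : Fin l ⊕ Fin n, (Quotient.mk (Connected a b) (outer p)) ≠ c}
  have e : {t : Fin m → Bool // Compatible b s t ∧ Compatible a t u} ≃ (C → Bool) := by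
    refine Equiv.ofBijective
      (fun t c => Quotient.lift (col t.1) ((compat t.1).1 t.2) c.1) ⟨?_, ?_⟩
    · rintro ⟨t, ht⟩ ⟨t', ht'⟩ htt
      refine Subtype.ext (funext fun j => ?_)
      by_cases hj : ∀ p : Fin l ⊕ Fin n,
          (Quotient.mk (Connected a b) (outer p)) ≠ Quotient.mk _ (.inr (.inl j))
      · exact congrFun htt ⟨_, hj⟩
      · push Not at hj
        obtain ⟨p, hp⟩ := hj
        have hp' : Connected a b (outer p) (.inr (.inl j)) := Quotient.exact hp
        have h1 := (compat t).1 ht _ _ hp'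
        have h2 := (compat t').1 ht' _ _ hp'
        rw [colO] at h1 h2
        exact h1.symm.trans h2
    · intro c
      let F : Quotient (Connected a b) → Bool := fun q =>
        if hq : ∀ p : Fin l ⊕ Fin n, (Quotient.mk (Connected a b) (outer p)) ≠ q then c ⟨q, hq⟩
        else Sum.elim s u (not_forall.1 hq).choose
      have FO : ∀ p : Fin l ⊕ Fin n, F (Quotient.mk _ (outer p)) = Sum.elim s u p := by
        intro p
        have hq : ¬ ∀ p' : Fin l ⊕ Fin n, (Quotient.mk (Connected a b) (outer p')) ≠
          Quotient.mk _ (outer p) := fun h => h p rfl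
        simp only [F, dif_neg hq]
        have := not_not.1 (not_forall.1 hq).choose_spec
        exact hcomp _ _ (Quotient.exact this)
      let t : Fin m → Bool := fun j => F (Quotient.mk _ (.inr (.inl j)))
      have hF : ∀ x, col t x = F (Quotient.mk _ x) := by
        rintro (i | j | k)
        · exact (FO (.inl i)).symm
        · rfl
        · exact (FO (.inr k)).symm
      have ht : Compatible b s t ∧ Compatible a t u := by
        rw [compat]
        intro x y hxy
        rw [hF, hF, Quotient.sound hxy]
      refine ⟨⟨t, ht⟩, funext fun c' => ?_⟩
      obtain ⟨q, hq⟩ := c'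
      induction q using Quotient.inductionOn with
      | h x =>
        change col t x = _
        rw [hF]
        simp only [F]
        rw [dif_pos hq]
  rw [Nat.card_congr e, Nat.card_fun]
  simp [loops, C]

theorem mat_mul {l m n : ℕ} (a : TLDiagram m n) (b : TLDiagram l m) :
    mat b * mat a = 2 ^ loops a b • mat (comp a b) := by
  classical
  ext s u
  have h1 : (mat b * mat a) s u =
      Nat.card {t : Fin m → Bool // Compatible b s t ∧ Compatible a t u} := by
    rw [Matrix.mul_apply, Nat.card_eq_fintype_card, Fintype.card_subtype, Finset.card_filter]
    refine Finset.sum_congr rfl fun t _ => ?_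
    simp only [mat]
    by_cases h : Compatible b s t <;> by_cases h' : Compatible a t u <;> simp [h, h']
  rw [h1, Matrix.smul_apply]
  by_cases h : Compatible (comp a b) s u
  · rw [card_middle a b s u h]
    simp [mat, h]
  · simp only [mat, h, if_false, smul_zero]
    rw [Nat.card_eq_zero]
    refine Or.inl ⟨fun ⟨t, hb, ha⟩ => h fun p => ?_⟩
    have hc : ∀ x y, Connected a b x y →
        (Sum.elim s (Sum.elim t u) x : Bool) = Sum.elim s (Sum.elim t u) y := by
      intro x y hxy
      induction hxy with
      | rel x y hxy =>
        rcases hxy with rfl | rfl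
        · rcases x with i | j | k
          · have := hb (.inl i)
            simp only [lowerStep]
            rw [Sum.elim_map]
            exact this.symm
          · have := hb (.inr j)
            simp only [lowerStep]
            rw [Sum.elim_map]
            exact this.symm
          · rfl
        · rcases x with i | p
          · rfl
          · exact (ha p).symm
      | refl => rfl
      | symm _ _ _ ih => exact ih.symm
      | trans _ _ _ _ _ ih1 ih2 => exact ih1.trans ih2
    have hO : ∀ p : Fin l ⊕ Fin n,
        (Sum.elim s (Sum.elim t u) (outer p) : Bool) = Sum.elim s u p := by
      rintro (i | i) <;> rfl
    rw [← hO, ← hO]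
    exact (hc _ _ ((connected_outer_iff a b p _).2 (Or.inr rfl))).symm

theorem mat_const {l n : ℕ} (a : TLDiagram l n) : mat a (fun _ => true) (fun _ => true) = 1 := by
  have : Compatible a (fun _ => true) (fun _ => true) := by
    intro p
    have h : ∀ q : Fin l ⊕ Fin n, (Sum.elim (fun _ => true) (fun _ => true) q : Bool) = true := by
      rintro (i | i) <;> rfl
    rw [h, h]
  simp [mat, this]

theorem eq_of_smul_mat {l n : ℕ} {i j : ℕ} {a b : TLDiagram l n}
    (h : 2 ^ i • mat a = 2 ^ j • mat b) : i = j ∧ a = b := by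
  have h1 := congrFun (congrFun h fun _ => true) fun _ => true
  rw [Matrix.smul_apply, Matrix.smul_apply, mat_const, mat_const] at h1
  have hij : i = j := Nat.pow_right_injective le_rfl (by simpa using h1)
  refine ⟨hij, eq_of_compatible a b fun s t hs => ?_⟩
  subst hij
  have h2 := congrFun (congrFun h s) t
  by_contra hb
  simp [mat, hs, hb] at h2

theorem comp_assoc_and_loops {k l m n : ℕ} (c : TLDiagram m n) (a : TLDiagram l m)
    (b : TLDiagram k l) :
    loops a b + loops c (comp a b) = loops c a + loops (comp c a) b ∧
      comp c (comp a b) = comp (comp c a) b := by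
  have h := Matrix.mul_assoc (mat b) (mat a) (mat c)
  rw [mat_mul, mat_mul, Matrix.smul_mul, Matrix.mul_smul, mat_mul, mat_mul, smul_smul, smul_smul,
    ← pow_add, ← pow_add] at h
  exact eq_of_smul_mat h

theorem comp_assoc {k l m n : ℕ} (c : TLDiagram m n) (a : TLDiagram l m) (b : TLDiagram k l) :
    comp c (comp a b) = comp (comp c a) b :=
  (comp_assoc_and_loops c a b).2

theorem loops_cocycle {k l m n : ℕ} (c : TLDiagram m n) (a : TLDiagram l m) (b : TLDiagram k l) :
    loops a b + loops c (comp a b) = loops c a + loops (comp c a) b :=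
  (comp_assoc_and_loops c a b).1

theorem mat_idDiag (n : ℕ) : mat (idDiag n) = 1 := by
  classical
  ext s t
  have : Compatible (idDiag n) s t ↔ s = t := by
    constructor
    · intro h
      funext i
      exact h (.inr i)
    · rintro rfl (i | i) <;> rfl
  simp only [mat, this, Matrix.one_apply]

theorem id_comp_and_loops {l n : ℕ} (a : TLDiagram l n) :
    loops (idDiag n) a = 0 ∧ comp (idDiag n) a = a := by
  have h := mat_mul (idDiag n) a
  rw [mat_idDiag, Matrix.mul_one] at h
  exact eq_of_smul_mat (by rw [← h, pow_zero, one_smul])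

theorem comp_id_and_loops {l n : ℕ} (a : TLDiagram l n) :
    loops a (idDiag l) = 0 ∧ comp a (idDiag l) = a := by
  have h := mat_mul a (idDiag l)
  rw [mat_idDiag, Matrix.one_mul] at h
  exact eq_of_smul_mat (by rw [← h, pow_zero, one_smul])

theorem mat_reflect {l n : ℕ} (a : TLDiagram l n) : mat (reflect a) = (mat a).transpose := by
  ext t s
  have e : ∀ p : Fin l ⊕ Fin n, (Sum.elim t s p.swap : Bool) = Sum.elim s t p := by
    rintro (i | i) <;> rfl
  have : Compatible (reflect a) t s ↔ Compatible a s t := by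
    constructor
    · intro h p
      have := h p.swap
      simp only [reflect, Sum.swap_swap] at this
      rw [e, e] at this
      exact this
    · intro h p
      have := h p.swap
      simp only [reflect]
      rw [e, this, ← e, Sum.swap_swap]
  by_cases h : Compatible a s t
  · simp [mat, Matrix.transpose_apply, this.2 h, h]
  · simp [mat, Matrix.transpose_apply, mt this.1 h, h]

theorem reflect_comp_and_loops {l m n : ℕ} (a : TLDiagram m n) (b : TLDiagram l m) :
    loops (reflect b) (reflect a) = loops a b ∧
      comp (reflect b) (reflect a) = reflect (comp a b) := by
  have h := mat_mul (reflect b) (reflect a)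
  rw [mat_reflect, mat_reflect, ← Matrix.transpose_mul, mat_mul, Matrix.transpose_smul,
    ← mat_reflect] at h
  exact eq_of_smul_mat h.symm

theorem reflect_reflect {l n : ℕ} (a : TLDiagram l n) : reflect (reflect a) = a := by
  ext p
  simp [reflect]

/-- A diagram is capless if no strand has both ends at the bottom. -/
def Capless {l n : ℕ} (a : TLDiagram l n) : Prop :=
  ∀ i j, a.partner (.inl i) ≠ .inl j

theorem Capless.of_comp {l m n : ℕ} {a : TLDiagram m n} {b : TLDiagram l m}
    (h : Capless (comp a b)) : Capless b := by
  intro i j hij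
  have h1 := connected_lower a b (.inl i)
  rw [hij] at h1
  have h2 := (connected_outer_iff a b (.inl i) (.inl j)).1 h1
  rcases h2 with h2 | h2
  · exact b.partner_ne _ (hij.trans (congrArg _ (Sum.inl.inj h2)))
  · exact h i j h2.symm

theorem capless_idDiag (n : ℕ) : Capless (idDiag n) := fun _ _ h => Sum.inr_ne_inl h

/-- The number of through strands: strands that connect the bottom with the top. -/
def throughStrands {l n : ℕ} (a : TLDiagram l n) : ℕ :=
  Fintype.card {i : Fin l // (a.partner (.inl i)).isRight}



end TLDiagram

open TLDiagram

/-- Crossingless matchings from `n` to `n` points, recorded as a matching without internal components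
together with the number of internal components, the latter counted in `Λ`. -/
@[ext]
structure CountedDiagram (Λ : Type*) (n : ℕ) where
  skeleton : TLDiagram n n
  bubbles : Λ

namespace CountedDiagram

variable {Λ : Type*} [AddCommMonoidWithOne Λ] {n : ℕ}

/-- `(a, i) (b, j) = (a b, i + j + Φ(a, b))`, where `Φ` counts the new internal components. -/
noncomputable instance : Monoid (CountedDiagram Λ n) where
  mul a b := ⟨comp a.skeleton b.skeleton, a.bubbles + b.bubbles + loops a.skeleton b.skeleton⟩
  one := ⟨idDiag n, 0⟩
  mul_assoc a b c := by
    refine CountedDiagram.ext (comp_assoc _ _ _).symm ?_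
    have h := congrArg (Nat.cast : ℕ → Λ) (loops_cocycle a.skeleton b.skeleton c.skeleton)
    push_cast at h
    change a.bubbles + b.bubbles + loops a.skeleton b.skeleton + c.bubbles +
        loops (comp a.skeleton b.skeleton) c.skeleton =
      a.bubbles + (b.bubbles + c.bubbles + loops b.skeleton c.skeleton) +
        loops a.skeleton (comp b.skeleton c.skeleton)
    calc _ = a.bubbles + b.bubbles + c.bubbles + ((loops a.skeleton b.skeleton : Λ) +
        loops (comp a.skeleton b.skeleton) c.skeleton) := by abel
      _ = _ := by rw [← h]; abel
  one_mul a := by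
    refine CountedDiagram.ext (id_comp_and_loops _).2 ?_
    change 0 + a.bubbles + loops (idDiag n) a.skeleton = a.bubbles
    rw [(id_comp_and_loops _).1]; simp
  mul_one a := by
    refine CountedDiagram.ext (comp_id_and_loops _).2 ?_
    change a.bubbles + 0 + loops a.skeleton (idDiag n) = a.bubbles
    rw [(comp_id_and_loops _).1]; simp

theorem mul_skeleton (a b : CountedDiagram Λ n) :
    (a * b).skeleton = comp a.skeleton b.skeleton := rfl

theorem mul_bubbles (a b : CountedDiagram Λ n) :
    (a * b).bubbles = a.bubbles + b.bubbles + loops a.skeleton b.skeleton := rfl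

theorem one_skeleton : (1 : CountedDiagram Λ n).skeleton = idDiag n := rfl

theorem one_bubbles : (1 : CountedDiagram Λ n).bubbles = 0 := rfl

/-- The diagrammatic anti-involution. -/
def star (a : CountedDiagram Λ n) : CountedDiagram Λ n :=
  ⟨reflect a.skeleton, a.bubbles⟩

end CountedDiagram

/-- The Kauffman monoid on `n` strands. -/
abbrev KauffmanMonoid (n : ℕ) := CountedDiagram ℕ n

/-- The `m`-cyclic Temperley–Lieb monoid on `n` strands: internal components are counted modulo
`m`. -/
abbrev CyclicTLMonoid (m n : ℕ) := CountedDiagram (ZMod m) n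

/-- The diagrams from `k` to `n` points without caps (and without internal components). -/
abbrev HalfDiagram (k n : ℕ) := {x : TLDiagram k n // Capless x}

section Cell

variable {Λ : Type*} [AddCommMonoidWithOne Λ] {A : Type*} [CommRing A]
  (τ : Multiplicative Λ →* A) (k n : ℕ)

open Classical in
/-- Concatenation of a diagram on top of a half diagram `x`; `i` internal components are replaced by
the scalar `τ i`, and the result is zero if it has a cap, i.e. fewer than `k` through strands. -/
noncomputable def cellActBasis (a : CountedDiagram Λ n) (x : HalfDiagram k n) :
    HalfDiagram k n →₀ A :=
  if h : Capless (comp a.skeleton x.1) then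
    Finsupp.single ⟨comp a.skeleton x.1, h⟩
      (τ (Multiplicative.ofAdd (a.bubbles + (loops a.skeleton x.1 : Λ))))
  else 0

/-- The action of diagrams on the free `A`-module on half diagrams by concatenation. -/
noncomputable def cellAction :
    CountedDiagram Λ n →* Module.End A (HalfDiagram k n →₀ A) where
  toFun a := Finsupp.linearCombination A (cellActBasis τ k n a)
  map_one' := by
    refine Finsupp.lhom_ext' fun x => LinearMap.ext_ring ?_
    have h1 := id_comp_and_loops x.1
    have h : Capless (comp (1 : CountedDiagram Λ n).skeleton x.1) := by
      rw [CountedDiagram.one_skeleton, h1.2]; exact x.2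
    simp only [LinearMap.coe_comp, Function.comp_apply, Finsupp.lsingle_apply,
      Finsupp.linearCombination_single, one_smul, Module.End.one_apply, cellActBasis, dif_pos h]
    congr 1
    · exact Subtype.ext h1.2
    · rw [CountedDiagram.one_skeleton, h1.1]
      simp [CountedDiagram.one_bubbles]
  map_mul' a b := by
    refine Finsupp.lhom_ext' fun x => LinearMap.ext_ring ?_
    simp only [LinearMap.coe_comp, Function.comp_apply, Finsupp.lsingle_apply,
      Finsupp.linearCombination_single, one_smul, Module.End.mul_apply]
    have hassoc := comp_assoc a.skeleton b.skeleton x.1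
    have hloops := loops_cocycle a.skeleton b.skeleton x.1
    by_cases hb : Capless (comp b.skeleton x.1)
    · have e1 : cellActBasis τ k n b x = Finsupp.single ⟨comp b.skeleton x.1, hb⟩
          (τ (Multiplicative.ofAdd (b.bubbles + (loops b.skeleton x.1 : Λ)))) := dif_pos hb
      rw [e1, Finsupp.linearCombination_single]
      by_cases ha : Capless (comp a.skeleton (comp b.skeleton x.1))
      · have ha' : Capless (comp (a * b).skeleton x.1) := by
          rw [CountedDiagram.mul_skeleton, ← hassoc]; exact ha
        rw [cellActBasis, cellActBasis, dif_pos ha', dif_pos ha, Finsupp.smul_single, smul_eq_mul,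
          ← map_mul, ← ofAdd_add]
        congr 1
        · exact Subtype.ext hassoc.symm
        · congr 2
          have h := congrArg (Nat.cast : ℕ → Λ) hloops
          push_cast at h
          rw [CountedDiagram.mul_bubbles, CountedDiagram.mul_skeleton]
          calc _ = a.bubbles + b.bubbles + ((loops a.skeleton b.skeleton : Λ) +
              loops (comp a.skeleton b.skeleton) x.1) := by abel
            _ = _ := by rw [← h]; abel
      · have ha' : ¬ Capless (comp (a * b).skeleton x.1) := by
          rw [CountedDiagram.mul_skeleton, ← hassoc]; exact ha
        rw [cellActBasis, cellActBasis, dif_neg ha', dif_neg ha, smul_zero]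
    · have hab : ¬ Capless (comp (a * b).skeleton x.1) := fun h => hb (by
        rw [CountedDiagram.mul_skeleton, ← hassoc] at h; exact h.of_comp)
      rw [cellActBasis, cellActBasis, dif_neg hab, dif_neg hb, map_zero]

open Classical in
/-- The value of the bilinear map on half diagrams `y` and `x`: stack `y*` on top of `x`. If the
result is the identity diagram on `k` strands together with `i` internal components, the value is
`τ i`; otherwise it is zero. -/
noncomputable def cellPairingBasis (y x : HalfDiagram k n) : A :=
  if comp (reflect y.1) x.1 = idDiag k then
    τ (Multiplicative.ofAdd (loops (reflect y.1) x.1 : Λ))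
  else 0

/-- The bilinear map on the free `A`-module on half diagrams. -/
noncomputable def cellPairing :
    (HalfDiagram k n →₀ A) →ₗ[A] (HalfDiagram k n →₀ A) →ₗ[A] A :=
  Finsupp.linearCombination A fun y => Finsupp.linearCombination A (cellPairingBasis τ k n y)

theorem cellPairing_single (y x : HalfDiagram k n) :
    cellPairing τ k n (Finsupp.single y 1) (Finsupp.single x 1) = cellPairingBasis τ k n y x := by
  simp [cellPairing]

theorem cellPairing_action (a : CountedDiagram Λ n) (w v : HalfDiagram k n →₀ A) :
    cellPairing τ k n w (cellAction τ k n a v) = cellPairing τ k n (cellAction τ k n a.star w) v := by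
  have key : (cellPairing τ k n).compl₂ (cellAction τ k n a) =
      (cellPairing τ k n) ∘ₗ (cellAction τ k n a.star) := by
    refine Finsupp.lhom_ext' fun y => LinearMap.ext_ring ?_
    refine Finsupp.lhom_ext' fun x => LinearMap.ext_ring ?_
    simp only [LinearMap.coe_comp, Function.comp_apply, Finsupp.lsingle_apply,
      LinearMap.compl₂_apply]
    have eL : cellAction τ k n a (Finsupp.single x 1) = cellActBasis τ k n a x := by
      simp [cellAction]
    have eR : cellAction τ k n a.star (Finsupp.single y 1) = cellActBasis τ k n a.star y := by
      simp [cellAction]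
    rw [eL, eR]
    have hassoc := comp_assoc (reflect y.1) a.skeleton x.1
    have hloops := loops_cocycle (reflect y.1) a.skeleton x.1
    have hr := reflect_comp_and_loops (reflect a.skeleton) y.1
    rw [reflect_reflect] at hr
    have lhs : cellPairing τ k n (Finsupp.single y 1) (cellActBasis τ k n a x) =
        open Classical in
        if comp (reflect y.1) (comp a.skeleton x.1) = idDiag k then
          τ (Multiplicative.ofAdd (a.bubbles + ((loops a.skeleton x.1 +
            loops (reflect y.1) (comp a.skeleton x.1) : ℕ) : Λ))) else 0 := by
      by_cases h : Capless (comp a.skeleton x.1)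
      · rw [cellActBasis, dif_pos h, ← mul_one (τ _), ← smul_eq_mul, ← Finsupp.smul_single,
          map_smul, cellPairing_single, cellPairingBasis]
        simp only
        split_ifs
        · rw [smul_eq_mul, ← map_mul, ← ofAdd_add, Nat.cast_add, add_assoc]
        · rw [smul_zero]
      · rw [cellActBasis, dif_neg h, map_zero, if_neg]
        intro h'
        refine h (Capless.of_comp (a := reflect y.1) ?_)
        rw [h']; exact capless_idDiag k
    have rhs : cellPairing τ k n (cellActBasis τ k n a.star y) (Finsupp.single x 1) =
        open Classical in
        if comp (comp (reflect y.1) a.skeleton) x.1 = idDiag k then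
          τ (Multiplicative.ofAdd (a.bubbles + ((loops (reflect y.1) a.skeleton +
            loops (comp (reflect y.1) a.skeleton) x.1 : ℕ) : Λ))) else 0 := by
      have hr2 : reflect (comp a.star.skeleton y.1) = comp (reflect y.1) a.skeleton := hr.2.symm
      by_cases h : Capless (comp a.star.skeleton y.1)
      · rw [cellActBasis, dif_pos h, ← mul_one (τ _), ← smul_eq_mul, ← Finsupp.smul_single,
          map_smul, LinearMap.smul_apply, cellPairing_single, cellPairingBasis]
        have hl : loops a.star.skeleton y.1 = loops (reflect y.1) a.skeleton := hr.1.symm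
        simp only [hl]
        rw [hr2]
        split_ifs
        · rw [smul_eq_mul, ← map_mul, ← ofAdd_add, Nat.cast_add, add_assoc]
          rfl
        · rw [smul_zero]
      · rw [cellActBasis, dif_neg h, map_zero, LinearMap.zero_apply, if_neg]
        intro h'
        refine h (Capless.of_comp (a := reflect x.1) ?_)
        have := (reflect_comp_and_loops (reflect (comp a.star.skeleton y.1)) x.1).2
        rw [reflect_reflect, hr2, h'] at this
        rw [this]
        exact capless_idDiag k
    rw [lhs, rhs, ← hassoc, hloops]
  exact LinearMap.congr_fun (LinearMap.congr_fun key w) v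

end Cell

section TLAlgebra

variable {𝕜 : Type*} [Field 𝕜] (δ : 𝕜) (k n : ℕ)

/-- The relation `o = δ · 1` on the algebra of the Kauffman monoid, where `o` is the identity diagram
with one internal component. -/
inductive TLRel : MonoidAlgebra 𝕜 (KauffmanMonoid n) → MonoidAlgebra 𝕜 (KauffmanMonoid n) → Prop
  | bubble : TLRel (MonoidAlgebra.of 𝕜 (KauffmanMonoid n) ⟨idDiag n, 1⟩)
      (algebraMap 𝕜 (MonoidAlgebra 𝕜 (KauffmanMonoid n)) δ)

/-- The Temperley–Lieb algebra with parameter `δ`. -/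
abbrev TLAlgebra := RingQuot (TLRel δ n)

/-- The underlying space of the cell representation `W(k)` of the Temperley–Lieb algebra: the span of
the half diagrams. -/
def TLCell (_δ : 𝕜) (k n : ℕ) := HalfDiagram k n →₀ 𝕜

noncomputable instance : AddCommGroup (TLCell δ k n) :=
  inferInstanceAs (AddCommGroup (HalfDiagram k n →₀ 𝕜))

noncomputable instance : Module 𝕜 (TLCell δ k n) :=
  inferInstanceAs (Module 𝕜 (HalfDiagram k n →₀ 𝕜))

/-- The action of the Temperley–Lieb algebra on `W(k)` by concatenation: internal components are
removed, each giving a factor `δ`. -/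
noncomputable def tlCellHom : TLAlgebra δ n →ₐ[𝕜] Module.End 𝕜 (HalfDiagram k n →₀ 𝕜) :=
  RingQuot.liftAlgHom 𝕜 ⟨MonoidAlgebra.lift 𝕜 (Module.End 𝕜 (HalfDiagram k n →₀ 𝕜))
    (KauffmanMonoid n) (cellAction (powersHom 𝕜 δ) k n), by
      rintro _ _ ⟨⟩
      rw [MonoidAlgebra.lift_of, AlgHom.commutes]
      refine Finsupp.lhom_ext' fun x => LinearMap.ext_ring ?_
      have h1 := id_comp_and_loops x.1
      have h : Capless (comp (idDiag n) x.1) := by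
        rw [h1.2]; exact x.2
      simp only [cellAction, MonoidHom.coe_mk, OneHom.coe_mk, LinearMap.coe_comp,
        Function.comp_apply, Finsupp.lsingle_apply, Finsupp.linearCombination_single, one_smul,
        cellActBasis, dif_pos h, h1.1]
      rw [Module.algebraMap_end_apply, Finsupp.smul_single]
      congr 1
      · exact Subtype.ext h1.2
      · simp⟩

noncomputable instance : Module (TLAlgebra δ n) (TLCell δ k n) :=
  Module.compHom (HalfDiagram k n →₀ 𝕜) (tlCellHom δ k n).toRingHom

theorem tlCell_smul_def (r : TLAlgebra δ n) (v : TLCell δ k n) : r • v = tlCellHom δ k n r v := rfl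

instance : IsScalarTower 𝕜 (TLAlgebra δ n) (TLCell δ k n) where
  smul_assoc c r v := by
    rw [tlCell_smul_def, tlCell_smul_def, map_smul]; rfl

/-- The canonical bilinear form on `W(k)`. -/
noncomputable def tlForm : TLCell δ k n →ₗ[𝕜] TLCell δ k n →ₗ[𝕜] 𝕜 :=
  cellPairing (powersHom 𝕜 δ) k n

/-- The radical `R(k)` of the canonical bilinear form, as a subrepresentation of `W(k)`. -/
noncomputable def tlRadical : Submodule (TLAlgebra δ n) (TLCell δ k n) where
  carrier := {v | ∀ w, tlForm δ k n w v = 0}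
  zero_mem' w := map_zero _
  add_mem' {v v'} hv hv' w := by rw [map_add, hv w, hv' w, add_zero]
  smul_mem' r v hv := by
    obtain ⟨x, rfl⟩ := RingQuot.mkAlgHom_surjective 𝕜 (TLRel δ n) r
    induction x using MonoidAlgebra.induction_on with
    | of a =>
      intro w
      rw [tlCell_smul_def, tlCellHom, RingQuot.liftAlgHom_mkAlgHom_apply, MonoidAlgebra.lift_of]
      exact (cellPairing_action (powersHom 𝕜 δ) k n a w v).trans (hv _)
    | add x y hx hy =>
      intro w
      rw [map_add, add_smul, map_add, hx w, hy w, add_zero]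
    | smul c x hx =>
      intro w
      rw [map_smul (RingQuot.mkAlgHom 𝕜 (TLRel δ n)) c x, smul_assoc,
        map_smul (tlForm δ k n w) c, hx w, smul_zero]

/-- The `k`-th simple representation `L(k) = W(k) / R(k)` of the Temperley–Lieb algebra. -/
abbrev TLSimple := TLCell δ k n ⧸ tlRadical δ k n

end TLAlgebra

section CyclicTL

variable (𝕜 : Type*) [Field 𝕜] (m k n : ℕ)

/-- The sandwiched algebra: the group algebra of the cyclic group of order `m`. -/
abbrev CyclicGroupAlgebra := MonoidAlgebra 𝕜 (Multiplicative (ZMod m))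

/-- The cell representation `Δ(k)`, the span of pairs `(x, i)` of a half diagram `x` and an element
`i` of the cyclic group: the free module over the group algebra on the half diagrams, where
`(x, i)` is `Finsupp.single x (MonoidAlgebra.of _ _ (ofAdd i))`. By reflection it is also the
underlying space of the right cell representation `∇(k)`, where a diagram acts from the right through
its reflection. -/
abbrev CyclicCell := HalfDiagram k n →₀ CyclicGroupAlgebra 𝕜 m

/-- The action of the cyclic Temperley–Lieb monoid on `Δ(k)` by concatenation. -/
noncomputable def cyclicAction :
    CyclicTLMonoid m n →* Module.End (CyclicGroupAlgebra 𝕜 m) (CyclicCell 𝕜 m k n) :=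
  cellAction (MonoidAlgebra.of 𝕜 (Multiplicative (ZMod m))) k n

/-- The bilinear map `φ^k`, with values in the sandwiched algebra. -/
noncomputable def cyclicPairing :
    CyclicCell 𝕜 m k n →ₗ[CyclicGroupAlgebra 𝕜 m]
      CyclicCell 𝕜 m k n →ₗ[CyclicGroupAlgebra 𝕜 m] CyclicGroupAlgebra 𝕜 m :=
  cellPairing (MonoidAlgebra.of 𝕜 (Multiplicative (ZMod m))) k n

/-- The map `Δ(k) → Hom_𝕜(∇(k), 𝕜 C_m)` induced by `φ^k`. -/
noncomputable def cyclicPairingHom :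
    CyclicCell 𝕜 m k n →ₗ[CyclicGroupAlgebra 𝕜 m]
      (CyclicCell 𝕜 m k n →ₗ[𝕜] CyclicGroupAlgebra 𝕜 m) where
  toFun v := ((cyclicPairing 𝕜 m k n).flip v).restrictScalars 𝕜
  map_add' v v' := by ext1 w; simp
  map_smul' r v := by ext1 w; simp

variable (K : Type*) [AddCommGroup K] [Module (CyclicGroupAlgebra 𝕜 m) K]

/-- The underlying space of the representation `Δ(k, K)`, the tensor product of `Δ(k)` and `K` over
the sandwiched algebra. -/
def InducedCell := TensorProduct (CyclicGroupAlgebra 𝕜 m) (CyclicCell 𝕜 m k n) K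

noncomputable instance : AddCommGroup (InducedCell 𝕜 m k n K) :=
  inferInstanceAs (AddCommGroup (TensorProduct (CyclicGroupAlgebra 𝕜 m) (CyclicCell 𝕜 m k n) K))

noncomputable instance : Module 𝕜 (InducedCell 𝕜 m k n K) :=
  inferInstanceAs (Module 𝕜 (TensorProduct (CyclicGroupAlgebra 𝕜 m) (CyclicCell 𝕜 m k n) K))

/-- The action of the monoid algebra of the cyclic Temperley–Lieb monoid on `Δ(k, K)`. -/
noncomputable def inducedCellHom : MonoidAlgebra 𝕜 (CyclicTLMonoid m n) →ₐ[𝕜]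
    Module.End (CyclicGroupAlgebra 𝕜 m)
      (TensorProduct (CyclicGroupAlgebra 𝕜 m) (CyclicCell 𝕜 m k n) K) :=
  MonoidAlgebra.lift 𝕜 _ _
    { toFun := fun a => LinearMap.rTensor K (cyclicAction 𝕜 m k n a)
      map_one' := by rw [map_one]; exact LinearMap.rTensor_id _ _
      map_mul' := fun a b => by rw [map_mul]; exact LinearMap.rTensor_comp _ _ _ }

noncomputable instance : Module (MonoidAlgebra 𝕜 (CyclicTLMonoid m n)) (InducedCell 𝕜 m k n K) :=
  Module.compHom (TensorProduct (CyclicGroupAlgebra 𝕜 m) (CyclicCell 𝕜 m k n) K)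
    (inducedCellHom 𝕜 m k n K).toRingHom

theorem inducedCell_smul_def (r : MonoidAlgebra 𝕜 (CyclicTLMonoid m n))
    (v : InducedCell 𝕜 m k n K) : r • v = inducedCellHom 𝕜 m k n K r v := rfl

instance : IsScalarTower 𝕜 (MonoidAlgebra 𝕜 (CyclicTLMonoid m n)) (InducedCell 𝕜 m k n K) where
  smul_assoc c r v := by
    rw [inducedCell_smul_def, inducedCell_smul_def, map_smul]; rfl

/-- The map `φ^k_K : Δ(k, K) → Hom_𝕜(∇(k), 𝕜 C_m) ⊗ K`. -/
noncomputable def inducedPairing :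
    TensorProduct (CyclicGroupAlgebra 𝕜 m) (CyclicCell 𝕜 m k n) K →ₗ[CyclicGroupAlgebra 𝕜 m]
      TensorProduct (CyclicGroupAlgebra 𝕜 m)
        (CyclicCell 𝕜 m k n →ₗ[𝕜] CyclicGroupAlgebra 𝕜 m) K :=
  LinearMap.rTensor K (cyclicPairingHom 𝕜 m k n)

/-- Precomposition of a linear form on `∇(k)` with the action of a diagram. -/
noncomputable def precompAction (a : CyclicTLMonoid m n) :
    (CyclicCell 𝕜 m k n →ₗ[𝕜] CyclicGroupAlgebra 𝕜 m) →ₗ[CyclicGroupAlgebra 𝕜 m]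
      (CyclicCell 𝕜 m k n →ₗ[𝕜] CyclicGroupAlgebra 𝕜 m) where
  toFun f := f ∘ₗ (cyclicAction 𝕜 m k n a.star).restrictScalars 𝕜
  map_add' _ _ := rfl
  map_smul' _ _ := rfl

theorem inducedPairing_action (a : CyclicTLMonoid m n)
    (v : TensorProduct (CyclicGroupAlgebra 𝕜 m) (CyclicCell 𝕜 m k n) K) :
    inducedPairing 𝕜 m k n K (LinearMap.rTensor K (cyclicAction 𝕜 m k n a) v) =
      LinearMap.rTensor K (precompAction 𝕜 m k n a) (inducedPairing 𝕜 m k n K v) := by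
  have h : cyclicPairingHom 𝕜 m k n ∘ₗ cyclicAction 𝕜 m k n a =
      precompAction 𝕜 m k n a ∘ₗ cyclicPairingHom 𝕜 m k n := by
    refine LinearMap.ext fun v => LinearMap.ext fun w => ?_
    exact cellPairing_action (MonoidAlgebra.of 𝕜 (Multiplicative (ZMod m))) k n a w v
  rw [inducedPairing, ← LinearMap.comp_apply, ← LinearMap.rTensor_comp, h, LinearMap.rTensor_comp,
    LinearMap.comp_apply]

/-- The kernel `R(k, K)` of `φ^k_K`, as a subrepresentation of `Δ(k, K)`. -/
noncomputable def inducedRadical :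
    Submodule (MonoidAlgebra 𝕜 (CyclicTLMonoid m n)) (InducedCell 𝕜 m k n K) where
  carrier := {v | inducedPairing 𝕜 m k n K v = 0}
  zero_mem' := map_zero (inducedPairing 𝕜 m k n K)
  add_mem' {v v'} hv hv' := by
    have := map_add (inducedPairing 𝕜 m k n K) v v'
    exact this.trans ((congrArg₂ (· + ·) hv hv').trans (add_zero _))
  smul_mem' r v hv := by
    induction r using MonoidAlgebra.induction_on with
    | of a =>
      change inducedPairing 𝕜 m k n K (inducedCellHom 𝕜 m k n K _ v) = 0
      rw [inducedCellHom, MonoidAlgebra.lift_of]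
      exact (inducedPairing_action 𝕜 m k n K a v).trans ((congrArg _ hv).trans (map_zero _))
    | add x y hx hy =>
      rw [add_smul]
      have := map_add (inducedPairing 𝕜 m k n K) (x • v) (y • v)
      exact this.trans ((congrArg₂ (· + ·) hx hy).trans (add_zero _))
    | smul c x hx =>
      have e : ∀ u : TensorProduct (CyclicGroupAlgebra 𝕜 m) (CyclicCell 𝕜 m k n) K,
          inducedPairing 𝕜 m k n K u = 0 → inducedPairing 𝕜 m k n K (c • u) = 0 := by
        intro u hu
        rw [← algebraMap_smul (CyclicGroupAlgebra 𝕜 m) c u, map_smul, hu, smul_zero]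
      rw [smul_assoc]
      exact e _ hx

/-- The representation `L(k, K) = Δ(k, K) / R(k, K)` of the cyclic Temperley–Lieb monoid. -/
abbrev CyclicTLSimple := InducedCell 𝕜 m k n K ⧸ inducedRadical 𝕜 m k n K

end CyclicTL

section Apex

/-- The two-sided cell order of a monoid. -/
def CellLE {S : Type*} [Monoid S] (a b : S) : Prop := ∃ c d, b = c * a * d

/-- The two-sided cells (`J`-cells) of a monoid: classes of `a ≤ b ∧ b ≤ a`. -/
def IsJCell {S : Type*} [Monoid S] (J : Set S) : Prop :=
  ∃ a, J = {b | CellLE a b ∧ CellLE b a}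

/-- A `J`-cell is idempotent if it contains an idempotent. -/
def IsIdempotentJCell {S : Type*} [Monoid S] (J : Set S) : Prop :=
  IsJCell J ∧ ∃ e ∈ J, e * e = e

/-- `J` acts by zero on the representation `M`. -/
def Annihilates (𝕜 : Type*) [Field 𝕜] {S : Type*} [Monoid S] (J : Set S) (M : Type*)
    [AddCommGroup M] [Module (MonoidAlgebra 𝕜 S) M] : Prop :=
  ∀ s ∈ J, ∀ v : M, MonoidAlgebra.of 𝕜 S s • v = 0

/-- `J` is an apex of `M`: a maximal element, in the two-sided cell order, among the idempotent
`J`-cells that do not annihilate `M`. -/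
def IsApex (𝕜 : Type*) [Field 𝕜] {S : Type*} [Monoid S] (J : Set S) (M : Type*)
    [AddCommGroup M] [Module (MonoidAlgebra 𝕜 S) M] : Prop :=
  (IsIdempotentJCell J ∧ ¬ Annihilates 𝕜 J M) ∧
    ∀ J' : Set S, IsIdempotentJCell J' → ¬ Annihilates 𝕜 J' M →
      (∀ a ∈ J, ∀ b ∈ J', CellLE a b) → J' = J

/-- The cell `J_k` of the cyclic Temperley–Lieb monoid: the diagrams with `k` through strands. -/
def throughCell (m k n : ℕ) : Set (CyclicTLMonoid m n) :=
  {a | throughStrands a.skeleton = k}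

end Apex

/-!
The group algebra `𝕜[ℤ/m]` acts on the one-dimensional module `K` through a character `χ`, and
applying `χ` to coordinates identifies `Δ(k, K)` with `W(k)` at `δ = ζ`, compatibly with the
diagrams and with the pairings. In these coordinates the diagram `x y*` sends a vector `v` to a
nonzero multiple of `⟨y, v⟩ x`, so a vector outside the radical generates the whole module: the
radical is the greatest proper submodule, and the quotient by it is simple. Both quotients have the
rank of the same Gram matrix as dimension. The apex is the cell with `k` through strands because
diagrams with fewer through strands act by zero on `Δ(k, K)`.
-/

namespace TLDiagram

variable {j k l m n : ℕ}

theorem partner_injective (a : TLDiagram l n) : Function.Injective a.partner :=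
  Function.Involutive.injective a.partner_partner

theorem partner_eq_comm (a : TLDiagram l n) {p q : Fin l ⊕ Fin n} :
    a.partner p = q ↔ a.partner q = p :=
  Function.Involutive.eq_iff a.partner_partner |>.trans eq_comm

instance : Finite (TLDiagram l n) :=
  Finite.of_injective TLDiagram.partner fun _ _ => TLDiagram.ext

theorem boundaryPos_inl (i : Fin l) : boundaryPos (.inl i : Fin l ⊕ Fin n) = i := rfl

theorem boundaryPos_inr (i : Fin n) :
    boundaryPos (.inr i : Fin l ⊕ Fin n) = l + (n - (i + 1)) := by
  simp only [boundaryPos, Sum.elim_inr, Fin.val_rev]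

theorem boundaryPos_sumMap_lt_iff {g : Fin k → Fin l} {f : Fin j → Fin n} (hg : StrictMono g)
    (hf : StrictMono f) (p q : Fin k ⊕ Fin j) :
    boundaryPos (Sum.map g f p) < boundaryPos (Sum.map g f q) ↔
      boundaryPos p < boundaryPos q := by
  rcases p with p | p <;> rcases q with q | q <;>
    simp only [Sum.map_inl, Sum.map_inr, boundaryPos_inl, boundaryPos_inr]
  · exact hg.lt_iff_lt
  · omega
  · omega
  · have := hf.lt_iff_lt (a := q) (b := p)
    simp only [Fin.lt_def] at this
    omega

theorem lt_of_partner_inl {a : TLDiagram l n} {i i' : Fin l} {t t' : Fin n}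
    (h : a.partner (.inl i) = .inr t) (h' : a.partner (.inl i') = .inr t') (hi : i < i') :
    t < t' := by
  have hne : t ≠ t' := by
    rintro rfl
    exact hi.ne (Sum.inl_injective (a.partner_injective (h.trans h'.symm)))
  have hcross := a.noncrossing (.inl i) (.inl i')
  rw [h, h'] at hcross
  simp only [boundaryPos_inl, boundaryPos_inr] at hcross
  omega

theorem reflect_partner_inl_eq_inr_iff (a : TLDiagram l n) {i : Fin l} {t : Fin n} :
    (reflect a).partner (.inl t) = .inr i ↔ a.partner (.inl i) = .inr t := by
  rw [a.partner_eq_comm]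
  change (a.partner (.inr t)).swap = Sum.swap (.inl i) ↔ _
  exact Sum.swap_leftInverse.injective.eq_iff

theorem eq_idDiag_of_partner_inl {a : TLDiagram n n}
    (h : ∀ i, a.partner (.inl i) = .inr i) : a = idDiag n := by
  ext p : 2
  rcases p with i | i
  · exact h i
  · exact a.partner_eq_comm.1 (h i)

section Comp

theorem comp_partner_eq_of_connected {a : TLDiagram m n} {b : TLDiagram l m} {p q : Fin l ⊕ Fin n}
    (h : Connected a b (outer p) (outer q)) (hne : q ≠ p) : (comp a b).partner p = q :=
  (((connected_outer_iff a b p q).1 h).resolve_left hne).symm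

theorem comp_partner_inl_of_cap (a : TLDiagram m n) {b : TLDiagram l m} {i i' : Fin l}
    (h : b.partner (.inl i) = .inl i') : (comp a b).partner (.inl i) = .inl i' := by
  refine comp_partner_eq_of_connected ?_ fun heq =>
    b.partner_ne (.inl i) (h.trans (congrArg _ (Sum.inl_injective heq)))
  have hcap := connected_lower a b (.inl i)
  rwa [h] at hcap

theorem comp_partner_inr_of_cup {a : TLDiagram m n} (b : TLDiagram l m) {t t' : Fin n}
    (h : a.partner (.inr t) = .inr t') : (comp a b).partner (.inr t) = .inr t' := by
  refine comp_partner_eq_of_connected ?_ fun heq =>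
    a.partner_ne (.inr t) (h.trans (congrArg _ (Sum.inr_injective heq)))
  have hcup := connected_upper a b (.inr t)
  rwa [h] at hcup

theorem comp_partner_inl_of_through {a : TLDiagram m n} {b : TLDiagram l m} {i : Fin l}
    {s : Fin m} {t : Fin n} (hb : b.partner (.inl i) = .inr s) (ha : a.partner (.inl s) = .inr t) :
    (comp a b).partner (.inl i) = .inr t := by
  refine comp_partner_eq_of_connected ?_ Sum.inr_ne_inl
  have hlower := connected_lower a b (.inl i)
  have hupper := connected_upper a b (.inl s)
  rw [hb] at hlower
  rw [ha] at hupper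
  exact (Connected a b).trans hlower hupper

end Comp

section Capless

theorem Capless.exists_strictMono {x : TLDiagram k n} (hx : Capless x) :
    ∃ f : Fin k → Fin n, StrictMono f ∧ ∀ i, x.partner (.inl i) = .inr (f i) := by
  have hthrough : ∀ i, ∃ t, x.partner (.inl i) = .inr t := fun i => by
    rcases hi : x.partner (.inl i) with t | t
    · exact absurd hi (hx i t)
    · exact ⟨t, rfl⟩
  choose f hf using hthrough
  exact ⟨f, fun i i' => lt_of_partner_inl (hf i) (hf i'), hf⟩

theorem Capless.eq_idDiag {a : TLDiagram n n} (ha : Capless a) : a = idDiag n := by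
  obtain ⟨f, hf, hpartner⟩ := ha.exists_strictMono
  refine eq_idDiag_of_partner_inl fun i => ?_
  rw [hpartner, hf.eq_id, id_eq]

theorem Capless.reflect_comp_self {x : TLDiagram k n} (hx : Capless x) :
    comp (reflect x) x = idDiag k := by
  obtain ⟨f, -, hpartner⟩ := hx.exists_strictMono
  exact eq_idDiag_of_partner_inl fun i =>
    comp_partner_inl_of_through (hpartner i) (x.reflect_partner_inl_eq_inr_iff.2 (hpartner i))

theorem Capless.comp_reflect_comp_cancel {y : TLDiagram k m} (hy : Capless y) (x : TLDiagram k n)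
    (z : TLDiagram l k) : comp (comp x (reflect y)) (comp y z) = comp x z := by
  rw [← comp_assoc x, comp_assoc (reflect y), hy.reflect_comp_self, (id_comp_and_loops z).2]

theorem Capless.comp_reflect_comp {y : TLDiagram k m} (hy : Capless y) (x : TLDiagram k n) :
    comp (comp x (reflect y)) y = x := by
  rw [← comp_assoc, hy.reflect_comp_self, (comp_id_and_loops x).2]

/-- The half diagram with `k` vertical strands on the left, followed by nested cups. -/
def nestedCups (hkn : k ≤ n) (hpar : k ≡ n [MOD 2]) : TLDiagram k n where
  partner := Sum.elim (fun i => .inr ⟨i, by omega⟩)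
    (fun t => if h : (t : ℕ) < k then .inl ⟨t, h⟩ else .inr ⟨n + k - 1 - t, by omega⟩)
  partner_partner := by
    rintro (i | t)
    · simp
    · by_cases h : (t : ℕ) < k
      · simp [h]
      · have h' : ¬ (n + k - 1 - (t : ℕ) < k) := by omega
        simp only [Sum.elim_inr, dif_neg h, dif_neg h']
        congr 1; ext; simp only; omega
  partner_ne := by
    rintro (i | t)
    · simp
    · by_cases h : (t : ℕ) < k
      · simp [h]
      · simp only [Sum.elim_inr, dif_neg h, ne_eq, Sum.inr.injEq, Fin.ext_iff]
        have : k % 2 = n % 2 := hpar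
        omega
  noncrossing := by
    rintro (i | i) (t | t)
    all_goals simp only [Sum.elim_inl, Sum.elim_inr]
    all_goals try split_ifs
    all_goals simp only [boundaryPos_inl, boundaryPos_inr]
    all_goals omega

theorem capless_nestedCups (hkn : k ≤ n) (hpar : k ≡ n [MOD 2]) :
    Capless (nestedCups hkn hpar) :=
  fun _ _ => Sum.inr_ne_inl

end Capless

section ThroughStrands

theorem throughStrands_comp_le_right (a : TLDiagram m n) (b : TLDiagram l m) :
    throughStrands (comp a b) ≤ throughStrands b := by
  refine Fintype.card_subtype_mono _ _ fun i hi => ?_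
  rcases hb : b.partner (.inl i) with i' | t
  · rw [comp_partner_inl_of_cap a hb] at hi
    exact absurd hi Bool.false_ne_true
  · rfl

theorem throughStrands_le_reflect (a : TLDiagram l n) :
    throughStrands a ≤ throughStrands (reflect a) := by
  have htop : ∀ i : {i : Fin l // (a.partner (.inl i)).isRight}, ∃ t,
      (reflect a).partner (.inl t) = .inr i.1 := fun i =>
    (Sum.isRight_iff.1 i.2).imp fun _ => a.reflect_partner_inl_eq_inr_iff.2
  choose f hf using htop
  refine Fintype.card_le_of_injective (fun i => ⟨f i, Sum.isRight_iff.2 ⟨_, hf i⟩⟩) ?_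
  intro i i' h
  have h' : f i = f i' := congrArg Subtype.val h
  exact Subtype.ext (Sum.inr_injective ((hf i).symm.trans (h' ▸ hf i')))

theorem throughStrands_reflect (a : TLDiagram l n) :
    throughStrands (reflect a) = throughStrands a :=
  le_antisymm (by simpa only [reflect_reflect] using throughStrands_le_reflect (reflect a))
    (throughStrands_le_reflect a)

theorem throughStrands_comp_le_left (a : TLDiagram m n) (b : TLDiagram l m) :
    throughStrands (comp a b) ≤ throughStrands a := by
  rw [← throughStrands_reflect, ← (reflect_comp_and_loops a b).2, ← throughStrands_reflect a]
  exact throughStrands_comp_le_right _ _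

theorem Capless.throughStrands_eq {x : TLDiagram k n} (hx : Capless x) : throughStrands x = k := by
  obtain ⟨f, -, hpartner⟩ := hx.exists_strictMono
  simp [throughStrands, hpartner]

theorem Capless.throughStrands_comp_reflect {x : TLDiagram k n} (hx : Capless x)
    {y : TLDiagram k l} (hy : Capless y) : throughStrands (comp x (reflect y)) = k := by
  refine le_antisymm ((throughStrands_comp_le_left _ _).trans hx.throughStrands_eq.le) ?_
  calc k = throughStrands (comp (comp x (reflect y)) y) := by
        rw [hy.comp_reflect_comp, hx.throughStrands_eq]
    _ ≤ throughStrands (comp x (reflect y)) := throughStrands_comp_le_left _ _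

theorem exists_through_strands (a : TLDiagram l n) (ha : throughStrands a = k) :
    ∃ (g : Fin k → Fin l) (f : Fin k → Fin n), StrictMono g ∧ StrictMono f ∧
      (∀ s, a.partner (.inl (g s)) = .inr (f s)) ∧
      ∀ i t, a.partner (.inl i) = .inr t → ∃ s, g s = i ∧ f s = t := by
  set S : Finset (Fin l) := {i | (a.partner (.inl i)).isRight} with hS
  have hcard : S.card = k := by rw [← ha, throughStrands, Fintype.card_subtype]
  have hrange : ∀ i, (∃ s, S.orderEmbOfFin hcard s = i) ↔ ∃ t, a.partner (.inl i) = .inr t :=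
    fun i => by
      rw [← Set.mem_range, Finset.range_orderEmbOfFin, Finset.mem_coe, hS, Finset.mem_filter_univ,
        Sum.isRight_iff]
  choose f hf using fun s => (hrange _).1 ⟨s, rfl⟩
  have hmono := (S.orderEmbOfFin hcard).strictMono
  refine ⟨_, f, hmono, fun s s' h => lt_of_partner_inl (hf s) (hf s') (hmono h), hf,
    fun i t hit => ?_⟩
  obtain ⟨s, rfl⟩ := (hrange i).2 ⟨t, hit⟩
  exact ⟨s, rfl, Sum.inr_injective ((hf s).symm.trans hit)⟩

end ThroughStrands

section Restrict

variable (a : TLDiagram l n) (φ : Fin k ⊕ Fin j → Fin l ⊕ Fin n)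
  (hφ : ∀ p q, boundaryPos (φ p) < boundaryPos (φ q) ↔ boundaryPos p < boundaryPos q)
  (hclosed : ∀ p, ∃ q, φ q = a.partner (φ p))

include hφ in
theorem injective_of_boundaryPos_lt_iff : Function.Injective φ := fun p q h =>
  boundaryPos_injective <| le_antisymm
    (not_lt.1 fun hlt => ((hφ q p).2 hlt).ne (by rw [h]))
    (not_lt.1 fun hlt => ((hφ p q).2 hlt).ne (by rw [h]))

/-- The strands of `a` that end in the image of `φ`, a set of boundary points that is a union of
strands and is listed by `φ` in boundary order. -/
noncomputable def restrict : TLDiagram k j where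
  partner p := (hclosed p).choose
  partner_partner p := injective_of_boundaryPos_lt_iff φ hφ <| by
    rw [(hclosed _).choose_spec, (hclosed p).choose_spec, a.partner_partner]
  partner_ne p h := a.partner_ne (φ p) <| by rw [← (hclosed p).choose_spec, h]
  noncrossing p q := by
    simpa only [← hφ, (hclosed _).choose_spec] using a.noncrossing (φ p) (φ q)

theorem map_restrict_partner (p : Fin k ⊕ Fin j) :
    φ ((restrict a φ hφ hclosed).partner p) = a.partner (φ p) :=
  (hclosed p).choose_spec

theorem restrict_partner_of_map {p q : Fin k ⊕ Fin j} (h : a.partner (φ p) = φ q) :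
    (restrict a φ hφ hclosed).partner p = q :=
  injective_of_boundaryPos_lt_iff φ hφ ((map_restrict_partner a φ hφ hclosed p).trans h)

end Restrict

theorem exists_comp_reflect_eq (a : TLDiagram l n) (ha : throughStrands a = k) :
    ∃ (x : TLDiagram k n) (y : TLDiagram k l), Capless x ∧ Capless y ∧ comp x (reflect y) = a := by
  obtain ⟨g, f, hg, hf, hgf, hall⟩ := exists_through_strands a ha
  have hfg : ∀ s, a.partner (.inr (f s)) = .inl (g s) := fun s => a.partner_eq_comm.1 (hgf s)
  have hx_closed : ∀ p, ∃ q, Sum.map g id q = a.partner (Sum.map g id p) := by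
    rintro (s | t)
    · exact ⟨.inr (f s), (hgf s).symm⟩
    · rcases ht : a.partner (.inr t) with i | t'
      · obtain ⟨s, rfl, -⟩ := hall i t (a.partner_eq_comm.1 ht)
        exact ⟨.inl s, ht.symm⟩
      · exact ⟨.inr t', ht.symm⟩
  have hz_closed : ∀ p, ∃ q, Sum.map id f q = a.partner (Sum.map id f p) := by
    rintro (i | s)
    · rcases hi : a.partner (.inl i) with i' | t
      · exact ⟨.inl i', hi.symm⟩
      · obtain ⟨s, -, rfl⟩ := hall i t hi
        exact ⟨.inr s, hi.symm⟩
    · exact ⟨.inl (g s), (hfg s).symm⟩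
  let x := restrict a (Sum.map g id) (boundaryPos_sumMap_lt_iff hg strictMono_id) hx_closed
  let z := restrict a (Sum.map id f) (boundaryPos_sumMap_lt_iff strictMono_id hf) hz_closed
  have hx : ∀ s, x.partner (.inl s) = .inr (f s) := fun s => restrict_partner_of_map _ _ _ _ (hgf s)
  have hz : ∀ s, z.partner (.inr s) = .inl (g s) := fun s => restrict_partner_of_map _ _ _ _ (hfg s)
  have hcomp : ∀ s, (comp x z).partner (.inl (g s)) = .inr (f s) := fun s =>
    comp_partner_inl_of_through (z.partner_eq_comm.1 (hz s)) (hx s)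
  refine ⟨x, reflect z, fun s s' => ?_, fun s s' => ?_, ?_⟩
  · rw [hx]; exact Sum.inr_ne_inl
  · rw [z.reflect_partner_inl_eq_inr_iff.2 (z.partner_eq_comm.1 (hz s))]; exact Sum.inr_ne_inl
  rw [reflect_reflect]
  ext p : 2
  rcases p with i | t
  · rcases hi : a.partner (.inl i) with i' | t
    · exact comp_partner_inl_of_cap x (restrict_partner_of_map _ _ _ _ hi)
    · obtain ⟨s, rfl, rfl⟩ := hall i t hi
      exact hcomp s
  · rcases ht : a.partner (.inr t) with i | t'
    · obtain ⟨s, rfl, rfl⟩ := hall i t (a.partner_eq_comm.1 ht)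
      exact (comp x z).partner_eq_comm.1 (hcomp s)
    · exact comp_partner_inr_of_cup z (restrict_partner_of_map _ _ _ _ ht)

end TLDiagram

section CellOrder

theorem CellLE.trans {S : Type*} [Monoid S] {a b c : S} (hab : CellLE a b) (hbc : CellLE b c) :
    CellLE a c := by
  obtain ⟨s, t, rfl⟩ := hab
  obtain ⟨u, v, rfl⟩ := hbc
  exact ⟨u * s, t * v, by simp only [mul_assoc]⟩

theorem IsJCell.eq_of_mem {S : Type*} [Monoid S] {J J' : Set S} (hJ : IsJCell J) (hJ' : IsJCell J')
    {b : S} (hb : b ∈ J) (hb' : b ∈ J') : J = J' := by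
  obtain ⟨a, rfl⟩ := hJ
  obtain ⟨a', rfl⟩ := hJ'
  ext c
  exact ⟨fun h => ⟨hb'.1.trans (hb.2.trans h.1), (h.2.trans hb.1).trans hb'.2⟩,
    fun h => ⟨hb.1.trans (hb'.2.trans h.1), (h.2.trans hb'.1).trans hb.2⟩⟩

end CellOrder

namespace CountedDiagram

variable {Λ : Type*} {k n : ℕ}

theorem throughStrands_le_of_cellLE [AddCommMonoidWithOne Λ] {a b : CountedDiagram Λ n}
    (h : CellLE a b) : throughStrands b.skeleton ≤ throughStrands a.skeleton := by
  obtain ⟨c, d, rfl⟩ := h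
  exact (throughStrands_comp_le_left _ _).trans (throughStrands_comp_le_right _ _)

section Group

variable [AddCommGroupWithOne Λ]

theorem cellLE_of_skeleton_eq {a b : CountedDiagram Λ n} (c d : TLDiagram n n)
    (h : b.skeleton = comp (comp c a.skeleton) d) : CellLE a b := by
  refine ⟨⟨c, b.bubbles - a.bubbles - loops c a.skeleton - loops (comp c a.skeleton) d⟩, ⟨d, 0⟩,
    CountedDiagram.ext h ?_⟩
  simp only [mul_bubbles, mul_skeleton]
  abel

theorem cellLE_of_throughStrands_eq {a b : CountedDiagram Λ n}
    (h : throughStrands a.skeleton = throughStrands b.skeleton) : CellLE a b := by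
  generalize hb : throughStrands b.skeleton = k at h
  obtain ⟨x, y, hx, hy, hxy⟩ := exists_comp_reflect_eq a.skeleton h
  obtain ⟨x', y', -, -, hxy'⟩ := exists_comp_reflect_eq b.skeleton hb
  refine cellLE_of_skeleton_eq (comp x' (reflect x)) (comp y (reflect y')) ?_
  rw [← hxy, ← hxy', hx.comp_reflect_comp_cancel, hy.comp_reflect_comp_cancel]

theorem isIdempotentJCell_setOf_throughStrands_eq (hkn : k ≤ n) (hpar : k ≡ n [MOD 2]) :
    IsIdempotentJCell {a : CountedDiagram Λ n | throughStrands a.skeleton = k} := by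
  set x := nestedCups hkn hpar
  have hx : Capless x := capless_nestedCups hkn hpar
  have hmem : throughStrands (comp x (reflect x)) = k := hx.throughStrands_comp_reflect hx
  refine ⟨⟨⟨comp x (reflect x), 0⟩, Set.ext fun b => ⟨fun hb => ?_, fun hb => ?_⟩⟩,
    ⟨comp x (reflect x), -loops (comp x (reflect x)) (comp x (reflect x))⟩, hmem,
    CountedDiagram.ext (hx.comp_reflect_comp_cancel x (reflect x)) ?_⟩
  · exact ⟨cellLE_of_throughStrands_eq (hmem.trans hb.symm),
      cellLE_of_throughStrands_eq (hb.trans hmem.symm)⟩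
  · exact le_antisymm ((throughStrands_le_of_cellLE hb.1).trans hmem.le)
      (hmem.ge.trans (throughStrands_le_of_cellLE hb.2))
  · exact neg_add_cancel_right _ _

end Group

end CountedDiagram

section CellForm

variable {Λ : Type*} [AddCommMonoidWithOne Λ] {A : Type*} [CommRing A]
  (τ : Multiplicative Λ →* A) {k n : ℕ}

theorem cellAction_single (a : CountedDiagram Λ n) (x : HalfDiagram k n) (c : A) :
    cellAction τ k n a (Finsupp.single x c) = c • cellActBasis τ k n a x :=
  Finsupp.linearCombination_single A c x

theorem map_ofAdd_natCast (i : ℕ) :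
    τ (Multiplicative.ofAdd (i : Λ)) = τ (Multiplicative.ofAdd 1) ^ i := by
  rw [← map_pow, ← ofAdd_nsmul, nsmul_one]

theorem cellPairing_self (x : HalfDiagram k n) :
    cellPairing τ k n (Finsupp.single x 1) (Finsupp.single x 1) =
      τ (Multiplicative.ofAdd 1) ^ loops (reflect x.1) x.1 := by
  rw [cellPairing_single, cellPairingBasis, if_pos x.2.reflect_comp_self, map_ofAdd_natCast]

theorem smul_cellActBasis_comp_reflect (x y z : HalfDiagram k n) :
    τ (Multiplicative.ofAdd (loops x.1 (reflect y.1) : Λ)) •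
        cellActBasis τ k n ⟨comp x.1 (reflect y.1), 0⟩ z =
      cellPairingBasis τ k n y z • Finsupp.single x 1 := by
  have hassoc := comp_assoc x.1 (reflect y.1) z.1
  have hloops := loops_cocycle x.1 (reflect y.1) z.1
  by_cases h : comp (reflect y.1) z.1 = idDiag k
  · rw [h, (comp_id_and_loops _).2] at hassoc
    rw [h, (comp_id_and_loops _).1, add_zero] at hloops
    have hcapless : Capless (comp (comp x.1 (reflect y.1)) z.1) := hassoc ▸ x.2
    rw [cellPairingBasis, if_pos h, cellActBasis, dif_pos hcapless, Finsupp.smul_single,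
      Finsupp.smul_single, smul_eq_mul, smul_eq_mul, mul_one, ← map_mul, ← ofAdd_add, zero_add,
      hloops, Nat.cast_add]
    congr 1
    exact Subtype.ext hassoc.symm
  · have hcap : ¬ Capless (comp (comp x.1 (reflect y.1)) z.1) := fun hc =>
      h (Capless.of_comp (hassoc ▸ hc)).eq_idDiag
    rw [cellPairingBasis, if_neg h, cellActBasis, dif_neg hcap, zero_smul, smul_zero]

theorem smul_cellAction_comp_reflect (x y : HalfDiagram k n) (v : HalfDiagram k n →₀ A) :
    τ (Multiplicative.ofAdd (loops x.1 (reflect y.1) : Λ)) •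
        cellAction τ k n ⟨comp x.1 (reflect y.1), 0⟩ v =
      cellPairing τ k n (Finsupp.single y 1) v • Finsupp.single x 1 := by
  suffices h : τ (Multiplicative.ofAdd (loops x.1 (reflect y.1) : Λ)) •
      cellAction τ k n ⟨comp x.1 (reflect y.1), 0⟩ =
        (cellPairing τ k n (Finsupp.single y 1)).smulRight (Finsupp.single x 1) from
    LinearMap.congr_fun h v
  refine Finsupp.lhom_ext' fun z => LinearMap.ext_ring ?_
  simpa only [LinearMap.coe_comp, Function.comp_apply, Finsupp.lsingle_apply,
    LinearMap.smul_apply, LinearMap.smulRight_apply, cellPairing_single, cellAction_single,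
    one_smul] using smul_cellActBasis_comp_reflect τ x y z

theorem cellAction_eq_zero_of_throughStrands_lt {a : CountedDiagram Λ n}
    (h : throughStrands a.skeleton < k) : cellAction τ k n a = 0 := by
  refine Finsupp.lhom_ext' fun x => LinearMap.ext_ring ?_
  refine (cellAction_single τ a x 1).trans ((one_smul A _).trans (dif_neg fun hcapless => ?_))
  refine h.not_ge ?_
  exact hcapless.throughStrands_eq.ge.trans (throughStrands_comp_le_left _ _)

/-- The Gram operator of the cell form: the coordinate of `cellGram τ k n v` at the half diagram
`y` is the pairing of `y` with `v`. Its kernel is the radical of the form. -/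
noncomputable def cellGram (k n : ℕ) : (HalfDiagram k n →₀ A) →ₗ[A] (HalfDiagram k n →₀ A) :=
  (Finsupp.linearEquivFunOnFinite A A (HalfDiagram k n)).symm.toLinearMap ∘ₗ
    LinearMap.pi fun y => cellPairing τ k n (Finsupp.single y 1)

theorem cellGram_apply (v : HalfDiagram k n →₀ A) (y : HalfDiagram k n) :
    cellGram τ k n v y = cellPairing τ k n (Finsupp.single y 1) v := rfl

theorem cellGram_single_self_ne_zero [IsReduced A] (hτ : τ (Multiplicative.ofAdd 1) ≠ 0)
    (x : HalfDiagram k n) : cellGram τ k n (Finsupp.single x 1) x ≠ 0 := by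
  rw [cellGram_apply, cellPairing_self]
  exact pow_ne_zero _ hτ

theorem cellPairing_eq_linearCombination (w v : HalfDiagram k n →₀ A) :
    cellPairing τ k n w v = Finsupp.linearCombination A (cellGram τ k n v) w := by
  suffices h : (cellPairing τ k n).flip v = Finsupp.linearCombination A (cellGram τ k n v) from
    LinearMap.congr_fun h w
  refine Finsupp.lhom_ext' fun y => LinearMap.ext_ring ?_
  simp [cellGram_apply]

theorem cellGram_eq_zero_iff {v : HalfDiagram k n →₀ A} :
    cellGram τ k n v = 0 ↔ ∀ w, cellPairing τ k n w v = 0 := by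
  refine ⟨fun h w => ?_, fun h => Finsupp.ext fun y => h _⟩
  simp [cellPairing_eq_linearCombination, h]

theorem cellGram_eq_powersHom :
    cellGram τ k n = cellGram (powersHom A (τ (Multiplicative.ofAdd 1))) k n := by
  have hbasis : cellPairingBasis τ k n =
      cellPairingBasis (powersHom A (τ (Multiplicative.ofAdd 1))) k n := by
    funext y x
    simp only [cellPairingBasis, map_ofAdd_natCast, powersHom_apply, toAdd_ofAdd, pow_one]
  rw [cellGram, cellGram, cellPairing, hbasis, cellPairing]

end CellForm

section BaseChange

variable {Λ : Type*} [AddCommMonoidWithOne Λ] {A B : Type*} [CommRing A] [CommRing B]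
  (f : A →+* B) (τ : Multiplicative Λ →* A) {k n : ℕ}

theorem mapRange_cellActBasis (a : CountedDiagram Λ n) (x : HalfDiagram k n) :
    (cellActBasis τ k n a x).mapRange f f.map_zero =
      cellActBasis ((f : A →* B).comp τ) k n a x := by
  unfold cellActBasis
  split_ifs
  · exact Finsupp.mapRange_single
  · exact Finsupp.mapRange_zero

theorem map_cellPairingBasis (y x : HalfDiagram k n) :
    f (cellPairingBasis τ k n y x) = cellPairingBasis ((f : A →* B).comp τ) k n y x := by
  unfold cellPairingBasis
  split_ifs
  · rfl
  · exact f.map_zero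

theorem mapRange_cellAction (a : CountedDiagram Λ n) (v : HalfDiagram k n →₀ A) :
    (cellAction τ k n a v).mapRange f f.map_zero =
      cellAction ((f : A →* B).comp τ) k n a (v.mapRange f f.map_zero) := by
  induction v using Finsupp.induction_linear with
  | zero => simp only [map_zero, Finsupp.mapRange_zero]
  | add v w hv hw => simp only [map_add, Finsupp.mapRange_add f.map_add, hv, hw]
  | single x c =>
    rw [cellAction_single, Finsupp.mapRange_single, cellAction_single, ← mapRange_cellActBasis]
    exact Finsupp.mapRange_smul' c (f c) _ fun r => f.map_mul c r

theorem mapRange_cellGram (v : HalfDiagram k n →₀ A) :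
    (cellGram τ k n v).mapRange f f.map_zero =
      cellGram ((f : A →* B).comp τ) k n (v.mapRange f f.map_zero) := by
  ext y
  induction v using Finsupp.induction_linear with
  | zero => simp only [map_zero, Finsupp.mapRange_zero]
  | add v w hv hw =>
    simp only [map_add, Finsupp.mapRange_add f.map_add, Finsupp.add_apply, hv, hw]
  | single x c =>
    simp only [Finsupp.mapRange_apply, cellGram_apply, cellPairing, Finsupp.mapRange_single,
      Finsupp.linearCombination_single, one_smul, smul_eq_mul, map_mul, map_cellPairingBasis]

end BaseChange

section GreatestProper

theorem isCoatom_of_isGreatest_ne_top {α : Type*} [PartialOrder α] [OrderTop α] {a : α}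
    (ha : IsGreatest {b | b ≠ ⊤} a) : IsCoatom a :=
  ⟨ha.1, fun _ hab => of_not_not fun hb => (ha.2 hb).not_gt hab⟩

theorem eq_jacobson_of_isGreatest_ne_top {S M : Type*} [Ring S] [AddCommGroup M] [Module S M]
    {R : Submodule S M} (hR : IsGreatest {N : Submodule S M | N ≠ ⊤} R) :
    R = Module.jacobson S M :=
  le_antisymm
    (le_sInf fun _ hN => ((IsCoatom.le_iff_eq hN hR.1).mp (hR.2 hN.1)).le)
    (sInf_le (isCoatom_of_isGreatest_ne_top hR))

end GreatestProper

/-- A presentation of a module `M` over an algebra `S` as a cell module of counted diagrams: the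
half diagrams form a basis of `M`, diagrams are realised in `S` and act on `M` by concatenation,
and `R` is the radical of the cell form. It puts `W(k)` and `Δ(k, K)` on the same footing. -/
structure CellPresentation {Λ 𝕜 S M : Type*} [AddCommMonoidWithOne Λ] [Field 𝕜] [Ring S]
    [AddCommGroup M] [Module 𝕜 M] [Module S M] (τ : Multiplicative Λ →* 𝕜) (k n : ℕ)
    (R : Submodule S M) where
  diagram : CountedDiagram Λ n → S
  coords : M ≃ₗ[𝕜] (HalfDiagram k n →₀ 𝕜)
  coords_diagram_smul : ∀ a v, coords (diagram a • v) = cellAction τ k n a (coords v)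
  mem_radical_iff : ∀ v, v ∈ R ↔ cellGram τ k n (coords v) = 0

namespace CellPresentation

variable {Λ 𝕜 S M : Type*} [AddCommMonoidWithOne Λ] [Field 𝕜] [Ring S] [AddCommGroup M]
  [Module 𝕜 M] [Module S M] {τ : Multiplicative Λ →* 𝕜} {k n : ℕ} {R : Submodule S M}

theorem smul_diagram_comp_reflect_smul (P : CellPresentation τ k n R)
    (x y : HalfDiagram k n) (v : M) :
    τ (Multiplicative.ofAdd (loops x.1 (reflect y.1) : Λ)) •
        P.diagram ⟨comp x.1 (reflect y.1), 0⟩ • v =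
      cellGram τ k n (P.coords v) y • P.coords.symm (Finsupp.single x 1) := by
  apply P.coords.injective
  rw [map_smul, P.coords_diagram_smul, smul_cellAction_comp_reflect, map_smul,
    P.coords.apply_symm_apply, cellGram_apply]

theorem le_throughStrands_of_diagram_smul_ne_zero (P : CellPresentation τ k n R)
    {a : CountedDiagram Λ n} {v : M} (h : P.diagram a • v ≠ 0) : k ≤ throughStrands a.skeleton := by
  by_contra! hlt
  refine h (P.coords.injective ?_)
  rw [P.coords_diagram_smul, cellAction_eq_zero_of_throughStrands_lt τ hlt, map_zero,
    LinearMap.zero_apply]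

theorem coords_symm_single_notMem (P : CellPresentation τ k n R)
    (hτ : τ (Multiplicative.ofAdd 1) ≠ 0) (x : HalfDiagram k n) :
    P.coords.symm (Finsupp.single x 1) ∉ R := by
  rw [P.mem_radical_iff, P.coords.apply_symm_apply]
  exact fun h => cellGram_single_self_ne_zero τ hτ x (DFunLike.congr_fun h x)

section Tower

variable [Algebra 𝕜 S] [IsScalarTower 𝕜 S M]

theorem diagram_smul_coords_symm_single_notMem (P : CellPresentation τ k n R)
    (hτ : τ (Multiplicative.ofAdd 1) ≠ 0) (x : HalfDiagram k n) :
    P.diagram ⟨comp x.1 (reflect x.1), 0⟩ • P.coords.symm (Finsupp.single x 1) ∉ R := by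
  intro h
  have hx := R.smul_of_tower_mem (τ (Multiplicative.ofAdd (loops x.1 (reflect x.1) : Λ))) h
  rw [P.smul_diagram_comp_reflect_smul, P.coords.apply_symm_apply] at hx
  exact P.coords_symm_single_notMem hτ x <|
    ((R.restrictScalars 𝕜).smul_mem_iff (cellGram_single_self_ne_zero τ hτ x)).mp hx

theorem eq_top_of_not_le (P : CellPresentation τ k n R) {N : Submodule S M} (hN : ¬ N ≤ R) :
    N = ⊤ := by
  obtain ⟨v, hvN, hvR⟩ := SetLike.not_le_iff_exists.mp hN
  obtain ⟨y, hy⟩ := Finsupp.ne_iff.mp (mt (P.mem_radical_iff v).mpr hvR)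
  have hbasis : ∀ x, P.coords.symm (Finsupp.single x 1) ∈ N.restrictScalars 𝕜 := by
    intro x
    rw [← (N.restrictScalars 𝕜).smul_mem_iff hy, ← P.smul_diagram_comp_reflect_smul]
    exact N.smul_of_tower_mem _ (N.smul_mem _ hvN)
  rw [← N.restrictScalars_eq_top_iff 𝕜, eq_top_iff, ← (Module.Basis.ofRepr P.coords).span_eq,
    Submodule.span_le]
  rintro _ ⟨x, rfl⟩
  exact hbasis x

theorem isGreatest_radical (P : CellPresentation τ k n R)
    [Nonempty (HalfDiagram k n)] (hτ : τ (Multiplicative.ofAdd 1) ≠ 0) :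
    IsGreatest {N : Submodule S M | N ≠ ⊤} R := by
  refine ⟨fun h => ?_, fun N hN => of_not_not fun h => hN (P.eq_top_of_not_le h)⟩
  exact P.coords_symm_single_notMem hτ (Classical.arbitrary _) (Submodule.eq_top_iff'.mp h _)

theorem isSimpleModule_quotient (P : CellPresentation τ k n R)
    [Nonempty (HalfDiagram k n)] (hτ : τ (Multiplicative.ofAdd 1) ≠ 0) : IsSimpleModule S (M ⧸ R) :=
  isSimpleModule_iff_isCoatom.mpr (isCoatom_of_isGreatest_ne_top (P.isGreatest_radical hτ))

theorem finite_quotient (P : CellPresentation τ k n R) : Module.Finite 𝕜 (M ⧸ R) :=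
  have := Module.Finite.equiv P.coords.symm
  Module.Finite.of_surjective (R.mkQ.restrictScalars 𝕜) R.mkQ_surjective

theorem finrank_quotient_eq_finrank_range_cellGram (P : CellPresentation τ k n R) :
    Module.finrank 𝕜 (M ⧸ R) = Module.finrank 𝕜 (LinearMap.range (cellGram τ k n)) := by
  have hker : R.restrictScalars 𝕜 = LinearMap.ker (cellGram τ k n ∘ₗ P.coords.toLinearMap) :=
    Submodule.ext fun v => P.mem_radical_iff v
  have hrange : LinearMap.range (cellGram τ k n ∘ₗ P.coords.toLinearMap) =
      LinearMap.range (cellGram τ k n) :=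
    LinearMap.range_comp_of_range_eq_top _ P.coords.range
  exact ((Submodule.Quotient.restrictScalarsEquiv 𝕜 R).symm ≪≫ₗ
    Submodule.quotEquivOfEq _ _ hker ≪≫ₗ LinearMap.quotKerEquivRange _ ≪≫ₗ
      LinearEquiv.ofEq _ _ hrange).finrank_eq

theorem finrank_quotient_eq (P : CellPresentation τ k n R) {Λ' S' M' : Type*}
    [AddCommMonoidWithOne Λ'] [Ring S'] [AddCommGroup M'] [Module 𝕜 M'] [Module S' M']
    [Algebra 𝕜 S'] [IsScalarTower 𝕜 S' M']
    {τ' : Multiplicative Λ' →* 𝕜} {R' : Submodule S' M'} (P' : CellPresentation τ' k n R')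
    (hττ' : τ (Multiplicative.ofAdd 1) = τ' (Multiplicative.ofAdd 1)) :
    Module.finrank 𝕜 (M ⧸ R) = Module.finrank 𝕜 (M' ⧸ R') := by
  rw [P.finrank_quotient_eq_finrank_range_cellGram, P'.finrank_quotient_eq_finrank_range_cellGram,
    cellGram_eq_powersHom τ, cellGram_eq_powersHom τ', hττ']

end Tower

end CellPresentation

/-- The cell presentation of the representation `W(k)` of the Temperley–Lieb algebra. -/
noncomputable def tlPresentation {𝕜 : Type*} [Field 𝕜] (δ : 𝕜) (k n : ℕ) :
    CellPresentation (powersHom 𝕜 δ) k n (tlRadical δ k n) where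
  diagram a := RingQuot.mkAlgHom 𝕜 (TLRel δ n) (MonoidAlgebra.of 𝕜 (KauffmanMonoid n) a)
  coords := LinearEquiv.refl 𝕜 (HalfDiagram k n →₀ 𝕜)
  coords_diagram_smul a v := by
    rw [tlCell_smul_def, tlCellHom, RingQuot.liftAlgHom_mkAlgHom_apply, MonoidAlgebra.lift_of]
    rfl
  mem_radical_iff _ := (cellGram_eq_zero_iff _).symm

section Line

open TensorProduct

variable {𝕜 : Type*} [Field 𝕜] {A : Type*} [CommRing A] [Algebra 𝕜 A] {K : Type*}
  [AddCommGroup K] [Module 𝕜 K] [Module A K] [IsScalarTower 𝕜 A K] (ε : K ≃ₗ[𝕜] 𝕜) {ι : Type*}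

theorem smul_eq_apply_smul_symm_one_smul (r : A) (v : K) : r • v = ε (r • ε.symm 1) • v := by
  have hline : ∀ w : K, w = ε w • ε.symm 1 := fun w => by
    rw [← map_smul, smul_eq_mul, mul_one, ε.symm_apply_apply]
  have := IsScalarTower.to_smulCommClass' (R := 𝕜) (A := A) (M := K)
  calc r • v = ε v • r • ε.symm 1 := by rw [← smul_comm r, ← hline]
    _ = ε v • ε (r • ε.symm 1) • ε.symm 1 := by rw [← hline]
    _ = ε (r • ε.symm 1) • v := by rw [smul_comm, ← hline]

/-- The character through which a commutative algebra acts on a one-dimensional module. -/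
noncomputable def lineCharacter : A →+* 𝕜 where
  toFun r := ε (r • ε.symm 1)
  map_one' := by rw [one_smul, ε.apply_symm_apply]
  map_mul' r s := by
    rw [mul_smul, smul_eq_apply_smul_symm_one_smul ε r (s • _), map_smul, smul_eq_mul]
  map_zero' := by rw [zero_smul, map_zero]
  map_add' r s := by rw [add_smul, map_add]

theorem smul_eq_lineCharacter_smul (r : A) (v : K) : r • v = lineCharacter ε r • v :=
  smul_eq_apply_smul_symm_one_smul ε r v

theorem lineCharacter_eq_of_smul_eq {r : A} {c : 𝕜} (h : ∀ v : K, r • v = c • v) :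
    lineCharacter ε r = c := by
  have h1 : lineCharacter ε r • ε.symm 1 = c • ε.symm 1 := by
    rw [← smul_eq_lineCharacter_smul, h]
  simpa using congrArg ε h1

/-- The linear form on a free module with prescribed values on the basis, depending linearly on
these values. -/
noncomputable def linearFormOfCoeffs (𝕜 A ι : Type*) [Field 𝕜] [CommRing A] [Algebra 𝕜 A] :
    (ι →₀ A) →ₗ[A] (ι →₀ A) →ₗ[𝕜] A :=
  LinearMap.restrictScalarsₗ 𝕜 A _ _ A ∘ₗ Finsupp.bilinearCombination A A ∘ₗ Finsupp.lcoeFun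

theorem linearFormOfCoeffs_apply (g w : ι →₀ A) :
    linearFormOfCoeffs 𝕜 A ι g w = Finsupp.linearCombination A g w := rfl

/-- Extension of scalars of a free module to a one-dimensional module, in coordinates. -/
noncomputable def lineCoords (ι : Type*) : (ι →₀ A) ⊗[A] K ≃ₗ[𝕜] (ι →₀ 𝕜) :=
  letI := Classical.decEq ι
  (TensorProduct.finsuppScalarLeft A K ι).restrictScalars 𝕜 ≪≫ₗ Finsupp.mapRange.linearEquiv ε

theorem lineCoords_tmul (f : ι →₀ A) (v : K) :
    lineCoords ε ι (f ⊗ₜ v) = ε v • f.mapRange (lineCharacter ε) (lineCharacter ε).map_zero := by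
  ext i
  simp only [lineCoords, LinearEquiv.trans_apply, LinearEquiv.restrictScalars_apply,
    Finsupp.mapRange.linearEquiv_apply, Finsupp.mapRange_apply,
    TensorProduct.finsuppScalarLeft_apply_tmul_apply, Finsupp.smul_apply]
  rw [smul_eq_lineCharacter_smul ε, map_smul, smul_eq_mul, smul_eq_mul,
    mul_comm]

theorem lineCoords_rTensor {T : (ι →₀ A) →ₗ[A] (ι →₀ A)} {T' : (ι →₀ 𝕜) →ₗ[𝕜] (ι →₀ 𝕜)}
    (h : ∀ f, (T f).mapRange (lineCharacter ε) (lineCharacter ε).map_zero =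
      T' (f.mapRange (lineCharacter ε) (lineCharacter ε).map_zero)) (v : (ι →₀ A) ⊗[A] K) :
    lineCoords ε ι (T.rTensor K v) = T' (lineCoords ε ι v) := by
  induction v using TensorProduct.induction_on with
  | zero => simp only [map_zero]
  | add u v hu hv => simp only [map_add, hu, hv]
  | tmul f v => rw [LinearMap.rTensor_tmul, lineCoords_tmul, lineCoords_tmul, map_smul, h]

end Line

section CyclicTemperleyLieb

open TensorProduct

variable {𝕜 : Type*} [Field 𝕜] {m k n : ℕ} {K : Type*} [AddCommGroup K]
  [Module (CyclicGroupAlgebra 𝕜 m) K]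

theorem cyclicPairingHom_eq_comp_cellGram :
    cyclicPairingHom 𝕜 m k n = linearFormOfCoeffs 𝕜 (CyclicGroupAlgebra 𝕜 m) (HalfDiagram k n) ∘ₗ
      cellGram (MonoidAlgebra.of 𝕜 (Multiplicative (ZMod m))) k n := by
  refine LinearMap.ext fun v => LinearMap.ext fun w => ?_
  change cyclicPairing 𝕜 m k n w v = _
  rw [cyclicPairing, cellPairing_eq_linearCombination, LinearMap.comp_apply,
    linearFormOfCoeffs_apply]

theorem cellGram_eq_comp_cyclicPairingHom :
    cellGram (MonoidAlgebra.of 𝕜 (Multiplicative (ZMod m))) k n =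
      ((Finsupp.linearEquivFunOnFinite _ _ (HalfDiagram k n)).symm.toLinearMap ∘ₗ
        LinearMap.pi fun y => LinearMap.applyₗ' (CyclicGroupAlgebra 𝕜 m) (Finsupp.single y 1)) ∘ₗ
          cyclicPairingHom 𝕜 m k n :=
  rfl

theorem inducedPairing_eq_zero_iff (v : CyclicCell 𝕜 m k n ⊗[CyclicGroupAlgebra 𝕜 m] K) :
    inducedPairing 𝕜 m k n K v = 0 ↔
      (cellGram (MonoidAlgebra.of 𝕜 (Multiplicative (ZMod m))) k n).rTensor K v = 0 := by
  constructor <;> intro h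
  · rw [cellGram_eq_comp_cyclicPairingHom, LinearMap.rTensor_comp_apply]
    exact (congrArg _ h).trans (map_zero _)
  · rw [inducedPairing, cyclicPairingHom_eq_comp_cellGram, LinearMap.rTensor_comp_apply, h,
      map_zero]

/-- The cell presentation of the representation `Δ(k, K)` of the cyclic Temperley–Lieb monoid for a
one-dimensional representation `K` of the cyclic group. -/
noncomputable def cyclicPresentation (k n : ℕ) [Module 𝕜 K]
    [IsScalarTower 𝕜 (CyclicGroupAlgebra 𝕜 m) K] (ε : K ≃ₗ[𝕜] 𝕜) :
    CellPresentation ((lineCharacter ε : CyclicGroupAlgebra 𝕜 m →+* 𝕜).toMonoidHom.comp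
      (MonoidAlgebra.of 𝕜 (Multiplicative (ZMod m)))) k n (inducedRadical 𝕜 m k n K) where
  diagram a := MonoidAlgebra.of 𝕜 (CyclicTLMonoid m n) a
  coords := lineCoords ε (HalfDiagram k n)
  coords_diagram_smul a v := by
    rw [inducedCell_smul_def, inducedCellHom, MonoidAlgebra.lift_of]
    exact lineCoords_rTensor ε (mapRange_cellAction (lineCharacter ε) _ a) v
  mem_radical_iff v := by
    refine (inducedPairing_eq_zero_iff v).trans ?_
    rw [← (lineCoords ε (HalfDiagram k n)).map_eq_zero_iff]
    exact Eq.congr_left (lineCoords_rTensor ε (mapRange_cellGram (lineCharacter ε) _) v)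

theorem isApex_throughCell (hkn : k ≤ n) (hpar : k ≡ n [MOD 2]) {τ : Multiplicative (ZMod m) →* 𝕜}
    (hτ : τ (Multiplicative.ofAdd 1) ≠ 0) {M : Type*} [AddCommGroup M] [Module 𝕜 M]
    [Module (MonoidAlgebra 𝕜 (CyclicTLMonoid m n)) M]
    [IsScalarTower 𝕜 (MonoidAlgebra 𝕜 (CyclicTLMonoid m n)) M]
    {R : Submodule (MonoidAlgebra 𝕜 (CyclicTLMonoid m n)) M} (P : CellPresentation τ k n R)
    (hP : P.diagram = MonoidAlgebra.of 𝕜 (CyclicTLMonoid m n)) :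
    IsApex 𝕜 (throughCell m k n) (M ⧸ R) := by
  have hid : IsIdempotentJCell (throughCell m k n) :=
    CountedDiagram.isIdempotentJCell_setOf_throughStrands_eq hkn hpar
  refine ⟨⟨hid, fun hann => ?_⟩, fun J' hJ' hann hle => ?_⟩
  · let x : HalfDiagram k n := ⟨nestedCups hkn hpar, capless_nestedCups hkn hpar⟩
    refine P.diagram_smul_coords_symm_single_notMem hτ x ?_
    rw [hP, ← Submodule.Quotient.mk_eq_zero, Submodule.Quotient.mk_smul]
    exact hann _ (x.2.throughStrands_comp_reflect x.2) _
  · obtain ⟨b, hb, v, hv⟩ : ∃ b ∈ J', ∃ v : M ⧸ R, MonoidAlgebra.of 𝕜 _ b • v ≠ 0 := by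
      simpa only [Annihilates, not_forall, exists_prop] using hann
    obtain ⟨e, he, -⟩ := hid.2
    have hb_le : throughStrands b.skeleton ≤ k :=
      (CountedDiagram.throughStrands_le_of_cellLE (hle e he b hb)).trans he.le
    obtain ⟨v, rfl⟩ := R.mkQ_surjective v
    have hb_ge : k ≤ throughStrands b.skeleton :=
      P.le_throughStrands_of_diagram_smul_ne_zero (v := v) fun h => hv <| by
        rw [← map_smul, ← hP, h, map_zero]
    exact hJ'.1.eq_of_mem hid.1 hb (le_antisymm hb_le hb_ge)

end CyclicTemperleyLieb

section SimpleModule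

theorem nonempty_linearEquiv_of_forall_exists_smul_eq {𝕜 A K : Type*} [Field 𝕜] [Ring A]
    [AddCommGroup K] [Module 𝕜 K] [Module A K] [IsSimpleModule A K]
    (h : ∀ r : A, ∃ c : 𝕜, ∀ v : K, r • v = c • v) : Nonempty (K ≃ₗ[𝕜] 𝕜) := by
  have := IsSimpleModule.nontrivial A K
  obtain ⟨v₀, hv₀⟩ := exists_ne (0 : K)
  refine ⟨(LinearEquiv.ofBijective (LinearMap.toSpanSingleton 𝕜 K v₀)
    ⟨smul_left_injective 𝕜 hv₀, fun v => ?_⟩).symm⟩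
  obtain ⟨r, rfl⟩ := IsSimpleModule.toSpanSingleton_surjective A hv₀ v
  obtain ⟨c, hc⟩ := h r
  exact ⟨c, (hc v₀).symm⟩

variable {𝕜 G K : Type*} [Field 𝕜] [Group G] [AddCommGroup K] [Module 𝕜 K]
  [Module (MonoidAlgebra 𝕜 G) K] {g : G} {ζ : 𝕜}

theorem ne_zero_of_forall_of_smul_eq [Nontrivial K]
    (hg : ∀ v : K, MonoidAlgebra.of 𝕜 G g • v = ζ • v) : ζ ≠ 0 := by
  rintro rfl
  obtain ⟨v, hv⟩ := exists_ne (0 : K)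
  have hunit := (Group.isUnit g).map (MonoidAlgebra.of 𝕜 G)
  exact hv (hunit.smul_eq_zero.mp ((hg v).trans (zero_smul 𝕜 v)))

theorem of_inv_smul_eq [Nontrivial K] (hg : ∀ v : K, MonoidAlgebra.of 𝕜 G g • v = ζ • v) (v : K) :
    MonoidAlgebra.of 𝕜 G g⁻¹ • v = ζ⁻¹ • v := by
  calc MonoidAlgebra.of 𝕜 G g⁻¹ • v
      = MonoidAlgebra.of 𝕜 G g⁻¹ • MonoidAlgebra.of 𝕜 G g • ζ⁻¹ • v := by
        rw [hg, smul_inv_smul₀ (ne_zero_of_forall_of_smul_eq hg)]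
    _ = ζ⁻¹ • v := by rw [← mul_smul, ← map_mul, inv_mul_cancel, map_one, one_smul]

theorem exists_forall_smul_eq_of_generator [Nontrivial K] [IsScalarTower 𝕜 (MonoidAlgebra 𝕜 G) K]
    (hgen : ∀ h, h ∈ Subgroup.zpowers g) (hg : ∀ v : K, MonoidAlgebra.of 𝕜 G g • v = ζ • v)
    (r : MonoidAlgebra 𝕜 G) : ∃ c : 𝕜, ∀ v : K, r • v = c • v := by
  induction r using MonoidAlgebra.induction_on with
  | of h =>
    obtain ⟨j, rfl⟩ := hgen h
    induction j with
    | zero => exact ⟨1, fun v => by simp only [zpow_zero, map_one, one_smul]⟩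
    | succ j ih =>
      obtain ⟨c, hc⟩ := ih
      exact ⟨c * ζ, fun v => by
        simp only [zpow_add_one, map_mul, mul_smul] at hc ⊢; rw [hg, hc]⟩
    | pred j ih =>
      obtain ⟨c, hc⟩ := ih
      exact ⟨c * ζ⁻¹, fun v => by
        simp only [zpow_sub_one, map_mul, mul_smul] at hc ⊢; rw [of_inv_smul_eq hg, hc]⟩
  | add r s hr hs =>
    obtain ⟨c, hc⟩ := hr
    obtain ⟨d, hd⟩ := hs
    exact ⟨c + d, fun v => by rw [add_smul, add_smul, hc, hd]⟩
  | smul a r hr =>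
    obtain ⟨c, hc⟩ := hr
    exact ⟨a * c, fun v => by rw [smul_assoc, hc, mul_smul]⟩

end SimpleModule

theorem mem_zpowers_ofAdd_one {m : ℕ} (g : Multiplicative (ZMod m)) :
    g ∈ Subgroup.zpowers (Multiplicative.ofAdd (1 : ZMod m)) := by
  obtain ⟨j, hj⟩ := ZMod.intCast_surjective g.toAdd
  exact ⟨j, by simp only [← ofAdd_zsmul, zsmul_one, hj, ofAdd_toAdd]⟩

theorem theoremT_general {𝕜 : Type*} [Field 𝕜] (m n k : ℕ) (hkn : k ≤ n) (hpar : k ≡ n [MOD 2])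
    (ζ : 𝕜) (K : Type*) [AddCommGroup K] [Module (CyclicGroupAlgebra 𝕜 m) K]
    [IsSimpleModule (CyclicGroupAlgebra 𝕜 m) K]
    (hKζ : ∀ v : K, MonoidAlgebra.of 𝕜 (Multiplicative (ZMod m)) (Multiplicative.ofAdd 1) • v =
      algebraMap 𝕜 (CyclicGroupAlgebra 𝕜 m) ζ • v) :
    inducedRadical 𝕜 m k n K =
        Module.jacobson (MonoidAlgebra 𝕜 (CyclicTLMonoid m n)) (InducedCell 𝕜 m k n K) ∧
      IsSimpleModule (MonoidAlgebra 𝕜 (CyclicTLMonoid m n)) (CyclicTLSimple 𝕜 m k n K) ∧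
      IsApex 𝕜 (throughCell m k n) (CyclicTLSimple 𝕜 m k n K) ∧
      IsSimpleModule (TLAlgebra ζ n) (TLSimple ζ k n) ∧
      Module.Finite 𝕜 (CyclicTLSimple 𝕜 m k n K) ∧
      Module.Finite 𝕜 (TLSimple ζ k n) ∧
      Module.finrank 𝕜 (CyclicTLSimple 𝕜 m k n K) = Module.finrank 𝕜 (TLSimple ζ k n) := by
  let : Module 𝕜 K := Module.compHom K (algebraMap 𝕜 (CyclicGroupAlgebra 𝕜 m))
  have : IsScalarTower 𝕜 (CyclicGroupAlgebra 𝕜 m) K := .of_algebraMap_smul fun _ _ => rfl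
  have : Nontrivial K := IsSimpleModule.nontrivial (CyclicGroupAlgebra 𝕜 m) K
  have : Nonempty (HalfDiagram k n) := ⟨⟨nestedCups hkn hpar, capless_nestedCups hkn hpar⟩⟩
  obtain ⟨ε⟩ := nonempty_linearEquiv_of_forall_exists_smul_eq
    (exists_forall_smul_eq_of_generator (ζ := ζ) mem_zpowers_ofAdd_one hKζ)
  have hζ0 : ζ ≠ 0 := ne_zero_of_forall_of_smul_eq (K := K) hKζ
  have hχ : lineCharacter ε (MonoidAlgebra.of 𝕜 _ (Multiplicative.ofAdd (1 : ZMod m))) = ζ :=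
    lineCharacter_eq_of_smul_eq ε hKζ
  have hδ : powersHom 𝕜 ζ (Multiplicative.ofAdd 1) = ζ := pow_one ζ
  let P := tlPresentation ζ k n
  let Q := cyclicPresentation (m := m) k n ε
  have hQ := hχ.trans_ne hζ0
  exact ⟨eq_jacobson_of_isGreatest_ne_top (Q.isGreatest_radical hQ),
    Q.isSimpleModule_quotient hQ, isApex_throughCell hkn hpar hQ Q rfl,
    P.isSimpleModule_quotient (hδ.trans_ne hζ0), Q.finite_quotient, P.finite_quotient,
    Q.finrank_quotient_eq P (hχ.trans hδ.symm)⟩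

theorem theoremT {𝕜 : Type*} [Field 𝕜] (m n k : ℕ) [NeZero m] (hkn : k ≤ n)
    (hpar : k ≡ n [MOD 2]) (hprim : ∃ ξ : 𝕜, IsPrimitiveRoot ξ m) (ζ : 𝕜) (hζ : ζ ^ m = 1)
    (K : Type*) [AddCommGroup K] [Module (CyclicGroupAlgebra 𝕜 m) K]
    (hK : IsSimpleModule (CyclicGroupAlgebra 𝕜 m) K)
    (hKζ : ∀ v : K, MonoidAlgebra.of 𝕜 (Multiplicative (ZMod m)) (Multiplicative.ofAdd 1) • v =
      algebraMap 𝕜 (CyclicGroupAlgebra 𝕜 m) ζ • v) :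
    inducedRadical 𝕜 m k n K =
        Module.jacobson (MonoidAlgebra 𝕜 (CyclicTLMonoid m n)) (InducedCell 𝕜 m k n K) ∧
      IsSimpleModule (MonoidAlgebra 𝕜 (CyclicTLMonoid m n)) (CyclicTLSimple 𝕜 m k n K) ∧
      IsApex 𝕜 (throughCell m k n) (CyclicTLSimple 𝕜 m k n K) ∧
      IsSimpleModule (TLAlgebra ζ n) (TLSimple ζ k n) ∧
      Module.Finite 𝕜 (CyclicTLSimple 𝕜 m k n K) ∧
      Module.Finite 𝕜 (TLSimple ζ k n) ∧
      Module.finrank 𝕜 (CyclicTLSimple 𝕜 m k n K) = Module.finrank 𝕜 (TLSimple ζ k n) := by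
  exact theoremT_general m n k hkn hpar ζ K hKζ
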